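/- Let $n\ge 1$, let $\eta\neq 0$ be a real number and let $J=\begin{pmatrix}0&I\\-I&0\end{pmatrix}$ be the standard symplectic $2n\times 2n$ matrix. For $\psi\in L^2(\mathbb{R}^n)$ the $\eta$-Wigner transform of $\psi$ is $$W_\eta\psi(x,p)=\Bigl(\tfrac{1}{2\pi|\eta|}\Bigr)^{n}\int_{\mathbb{R}^n} e^{-\frac{i}{\eta}p\cdot y}\,\psi(x+\tfrac12 y)\,\overline{\psi(x-\tfrac12 y)}\,d^ny .$$ A density matrix is a positive trace class operator $\widehat\rho$ on $L^2(\mathbb{R}^n)$ of trace one; its $\eta$-Wigner transform is $\rho=\sum_j\alpha_jW_\eta\psi_j$, where $\widehat\rho=\sum_j\alpha_j|\psi_j\rangle\langle\psi_j|$ with $\alpha_j\ge 0$, $\sum_j\alpha_j=1$, $\|\psi_j\|=1$. Assume that $$\int_{\mathbb{R}^{2n}}(1+|z|^2)\,|\rho(z)|\,d^{2n}z<\infty$$ and let $\Sigma$ be the covariance matrix of $\rho$, that is, with $z=(x,p)$, $$\Sigma_{\alpha\beta}=\int(z_\alpha-\langle z_\alpha\rangle)(z_\beta-\langle z_\beta\rangle)\rho(z)\,d^{2n}z,\qquad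 \langle z_\alpha\rangle=\int z_\alpha\,\rho(z)\,d^{2n}z .$$ The symplectic eigenvalues of a real symmetric positive definite $2n\times 2n$ matrix $\Sigma$ are the numbers $\lambda>0$ such that $i\lambda$ is an eigenvalue of $\Sigma J$. Theorem. (i) The Hermitian matrix $\Sigma+\frac{i\eta}{2}J$ is positive semidefinite. Moreover $\Sigma$ is positive definite, and if $\lambda_{\min}$ denotes its smallest symplectic eigenvalue then, for every real $\eta'$, the condition $\Sigma+\frac{i\eta'}{2}J\ge 0$ is equivalent to $|\eta'|\le 2\lambda_{\min}$ (in particular $|\eta|\le 2\lambda_{\min}$). (ii) If these two equivalent conditions hold for some real number $\eta_1$ (for instance $\eta_1=\eta$), then they hold for every real $\eta_2$ with $|\eta_2|\le|\eta_1|$. -/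

import Mathlib

open MeasureTheory
open scoped ComplexOrder

noncomputable section

namespace EtaQuantum

/-- The configuration space of `n` degrees of freedom. -/
abbrev Config (n : ℕ) : Type := EuclideanSpace ℝ (Fin n)

/-- The phase space of points `z = (x, p)`, with Lebesgue measure `d^n x d^n p`. -/
abbrev Phase (n : ℕ) : Type := Config n × Config n

/-- The Hilbert space of square integrable complex functions on configuration space. -/
abbrev StateSpace (n : ℕ) : Type := Lp ℂ 2 (volume : Measure (Config n))

/-- A density matrix on a Hilbert space: a bounded positive operator which is of trace class with
trace one. For a positive operator this means that the sum of its (nonnegative) diagonal elements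
in an orthonormal basis converges to `1`; this does not depend on the basis. -/
def IsDensityMatrix {H : Type} [NormedAddCommGroup H] [InnerProductSpace ℂ H] [CompleteSpace H]
    (T : H →L[ℂ] H) : Prop :=
  T.IsPositive ∧
    ∃ (ι : Type) (b : HilbertBasis ι ℂ H), HasSum (fun j => inner ℂ (b j) (T (b j))) (1 : ℂ)

/-- The `η`-Wigner transform of `ψ`,
`(2π|η|)⁻ⁿ ∫ exp (-(i/η) p·y) ψ (x + y/2) ψ* (x - y/2) dⁿy`, at the point `z = (x, p)`. -/
def wigner {n : ℕ} (η : ℝ) (ψ : Config n → ℂ) (z : Phase n) : ℂ :=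
  (((1 / (2 * Real.pi * |η|)) ^ n : ℝ) : ℂ) *
    ∫ y : Config n, Complex.exp (-(Complex.I / (η : ℂ)) * ((inner ℝ z.2 y : ℝ) : ℂ)) *
      ψ (z.1 + (1 / 2 : ℝ) • y) * starRingEnd ℂ (ψ (z.1 - (1 / 2 : ℝ) • y))

/-- `ρ` is the `η`-Wigner transform of the operator `T`: writing `T = ∑ α_j |ψ_j⟩⟨ψ_j|` as a
convex combination of projections on normalized pure states, one has
`ρ = ∑ α_j W_η ψ_j` (almost everywhere). -/
def IsWignerTransform {n : ℕ} (η : ℝ) (T : StateSpace n →L[ℂ] StateSpace n)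
    (ρ : Phase n → ℝ) : Prop :=
  ∃ (α : ℕ → ℝ) (ψ : ℕ → StateSpace n),
    (∀ j, 0 ≤ α j) ∧ HasSum α 1 ∧ (∀ j, ‖ψ j‖ = 1) ∧
    (∀ φ : StateSpace n, HasSum (fun j => (α j : ℂ) • (inner ℂ (ψ j) φ • ψ j)) (T φ)) ∧
    ∀ᵐ z : Phase n, HasSum (fun j => (α j : ℂ) * wigner η (ψ j) z) (ρ z : ℂ)

/-- The coordinates of `z = (x, p)`: first the `x_j`, then the `p_j`. -/
def coord {n : ℕ} (z : Phase n) : Fin n ⊕ Fin n → ℝ :=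
  Sum.elim (fun j => z.1 j) (fun j => z.2 j)

/-- The average `⟨z_a⟩` with respect to `ρ`. -/
def average {n : ℕ} (ρ : Phase n → ℝ) (a : Fin n ⊕ Fin n) : ℝ :=
  ∫ z : Phase n, coord z a * ρ z

/-- The covariance matrix of `ρ`. -/
def covMatrix {n : ℕ} (ρ : Phase n → ℝ) : Matrix (Fin n ⊕ Fin n) (Fin n ⊕ Fin n) ℝ :=
  Matrix.of fun a b =>
    ∫ z : Phase n, (coord z a - average ρ a) * (coord z b - average ρ b) * ρ z

/-- The standard symplectic matrix `(0, I; -I, 0)`. -/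
def stdJ (n : ℕ) : Matrix (Fin n ⊕ Fin n) (Fin n ⊕ Fin n) ℝ :=
  Matrix.fromBlocks 0 1 (-1) 0

/-- The complex matrix `S + (iη/2) J`. -/
def uncertaintyMatrix {n : ℕ} (S : Matrix (Fin n ⊕ Fin n) (Fin n ⊕ Fin n) ℝ) (η : ℝ) :
    Matrix (Fin n ⊕ Fin n) (Fin n ⊕ Fin n) ℂ :=
  S.map Complex.ofReal + (Complex.I * (η : ℂ) / 2) • (stdJ n).map Complex.ofReal

/-- The symplectic eigenvalues of a symmetric positive definite matrix `S`: the numbers `l > 0`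
such that `i l` is an eigenvalue of `S J`. -/
def symplecticEigenvalues {n : ℕ} (S : Matrix (Fin n ⊕ Fin n) (Fin n ⊕ Fin n) ℝ) : Set ℝ :=
  {l | 0 < l ∧ Module.End.HasEigenvalue
    (Matrix.toLin' ((S * stdJ n).map Complex.ofReal)) (Complex.I * (l : ℂ))}

end EtaQuantum

end

/-!
The proof has an analytic half, which gives the uncertainty principle `Σ + (iη/2) J ≥ 0`, and a
linear-algebraic half, which describes all `η'` with `Σ + (iη'/2) J ≥ 0`.

*Uncertainty principle.* The characteristic function `χ(a, b) = ∫ exp (i (a·x + b·p)) ρ(x, p)` of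
the Wigner transform of a mixture of states `ψ_j` with weights `α_j` is the mixture of the
ambiguity functions of the `ψ_j` at `(a, η b)` (`hasSum_ambiguity`). The individual `W_η ψ_j` are
bounded but need not be integrable, so the identity is obtained by inserting a Gaussian cutoff in
`x` and `p`; the cutoff integral is, by Fubini, a Gaussian average of ambiguity functions near
`(a, η b)`, and removing the cutoff rests on the continuity of translations in `L²`. Ambiguity
functions are, up to a symplectic phase, overlaps of Weyl translates of `ψ_j`, whence `χ` is twisted
positive definite: `∑ c_k c_l* exp (iη σ(w_k, w_l) / 2) χ(w_k - w_l) ≥ 0`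
(`re_sum_charFn_nonneg`). For weights of total mass zero and points `t w_k`, dividing by `t²` and
letting `t → 0` leaves a second moment of `ρ` plus the symplectic form
(`integral_norm_sq_add_nonneg`); the points `0, u, w` with weights `-1 - i, 1, i`, with phases that
move the origin to the mean of `ρ`, give `η uᵀ J w ≤ uᵀ Σ u + wᵀ Σ w` for all real `u`, `w`. This is
the positivity of `Σ + (iη/2) J` evaluated at `u + i w`, and as `η ≠ 0` and `J` is invertible it
also forces `Σ` to be positive definite. The limits use the second moment hypothesis on `ρ`.

*Symplectic eigenvalues.* Since `Σ` is positive definite and `i J` is indefinite, the pencil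
`Σ + t i J` leaves the positive semidefinite cone at some largest `t > 0`, where it is singular
(`exists_posSemidef_not_posDef`). The map `J` carries the kernel of `Σ + l i J` to the eigenspace of
`Σ J` for `i l`, so this `t` is a symplectic eigenvalue; evaluating the form at a kernel vector
shows that it is the least one, and convexity together with complex conjugation shows that
`Σ + (iη'/2) J ≥ 0` exactly when `|η'| ≤ 2t` (`exists_isLeast_symplecticEigenvalues`).
-/

noncomputable section

namespace EtaQuantum

/-! ### Matrix pencils and symplectic eigenvalues -/

section Pencil

open Matrix

variable {ι : Type*} [Fintype ι]

/-- A positive definite matrix stays positive semidefinite under small Hermitian perturbations. -/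
theorem exists_pos_add_smul_posSemidef {B K : Matrix ι ι ℂ} (hB : B.PosDef)
    (hK : K.IsHermitian) : ∃ ε : ℝ, 0 < ε ∧ (B + (ε : ℂ) • K).PosSemidef := by
  have hcB : Continuous fun v : ι → ℂ => (star v ⬝ᵥ (B *ᵥ v)).re := by fun_prop
  have hcK : Continuous fun v : ι → ℂ => (star v ⬝ᵥ (K *ᵥ v)).re := by fun_prop
  have hS : IsCompact (Metric.sphere (0 : ι → ℂ) 1) := isCompact_sphere 0 1
  obtain ⟨C, hC⟩ := hS.exists_bound_of_continuousOn hcK.continuousOn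
  obtain ⟨m, hm, hmB⟩ : ∃ m : ℝ, 0 < m ∧
      ∀ v ∈ Metric.sphere (0 : ι → ℂ) 1, m ≤ (star v ⬝ᵥ (B *ᵥ v)).re := by
    rcases (Metric.sphere (0 : ι → ℂ) 1).eq_empty_or_nonempty with h | h
    · exact ⟨1, one_pos, by simp [h]⟩
    · obtain ⟨v, hv, hmin⟩ := hS.exists_isMinOn h hcB.continuousOn
      refine ⟨_, ?_, fun w hw => hmin hw⟩
      have hv0 : v ≠ 0 := by
        rintro rfl
        simp at hv
      exact (Complex.lt_def.1 (hB.dotProduct_mulVec_pos hv0)).1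
  have hherm : (B + ((m / (|C| + 1) : ℝ) : ℂ) • K).IsHermitian := by
    refine hB.isHermitian.add ?_
    rw [Matrix.IsHermitian, conjTranspose_smul, hK.eq]
    simp
  refine ⟨m / (|C| + 1), by positivity, .of_dotProduct_mulVec_nonneg hherm fun v => ?_⟩
  rw [Complex.nonneg_iff]
  refine ⟨?_, (hherm.im_star_dotProduct_mulVec_self v).symm⟩
  -- both forms scale by `‖v‖ ^ 2`, so it suffices to treat the unit vector `u = v / ‖v‖`
  by_cases hv : v = 0
  · simp [hv]
  have hr : 0 < ‖v‖ := norm_pos_iff.2 hv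
  set u : ι → ℂ := ((‖v‖⁻¹ : ℝ) : ℂ) • v with hu
  have huS : u ∈ Metric.sphere (0 : ι → ℂ) 1 := by
    rw [mem_sphere_zero_iff_norm, hu, norm_smul, Complex.norm_real, norm_inv, norm_norm,
      inv_mul_cancel₀ hr.ne']
  have hvu : v = ((‖v‖ : ℝ) : ℂ) • u := by
    rw [hu, smul_smul, ← Complex.ofReal_mul, mul_inv_cancel₀ hr.ne', Complex.ofReal_one, one_smul]
  have key : 0 ≤ (star u ⬝ᵥ (B *ᵥ u)).re + m / (|C| + 1) * (star u ⬝ᵥ (K *ᵥ u)).re := by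
    have h1 := hmB u huS
    have h2 := hC u huS
    rw [Real.norm_eq_abs] at h2
    have h3 : -(|C| + 1) ≤ (star u ⬝ᵥ (K *ᵥ u)).re := by
      have := (abs_le.1 h2).1
      have := le_abs_self C
      linarith
    have h4 : m / (|C| + 1) * (-(|C| + 1)) ≤ m / (|C| + 1) * (star u ⬝ᵥ (K *ᵥ u)).re :=
      mul_le_mul_of_nonneg_left h3 (by positivity)
    have h5 : m / (|C| + 1) * (-(|C| + 1)) = -m := by
      have : |C| + 1 ≠ 0 := by positivity
      field_simp
    linarith
  have : (star v ⬝ᵥ ((B + ((m / (|C| + 1) : ℝ) : ℂ) • K) *ᵥ v)) = ((‖v‖ ^ 2 : ℝ) : ℂ) *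
      ((star u ⬝ᵥ (B *ᵥ u)) + ((m / (|C| + 1) : ℝ) : ℂ) * (star u ⬝ᵥ (K *ᵥ u))) := by
    rw [hvu]
    simp only [star_smul, mulVec_smul, smul_dotProduct, dotProduct_smul, add_mulVec, smul_mulVec,
      dotProduct_add, smul_eq_mul, Complex.star_def, Complex.conj_ofReal]
    rw [← hvu]
    push_cast
    ring
  rw [this, Complex.re_ofReal_mul, Complex.add_re, Complex.re_ofReal_mul]
  positivity

/-- A Hermitian pencil `A + t K` that starts at a positive definite matrix and is not positive
semidefinite for all `t > 0` leaves the positive semidefinite cone through a singular matrix. -/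
theorem exists_posSemidef_not_posDef {A K : Matrix ι ι ℂ} (hA : A.PosDef) (hK : K.IsHermitian)
    {x : ι → ℂ} (hx : (star x ⬝ᵥ (K *ᵥ x)).re < 0) :
    ∃ t : ℝ, 0 < t ∧ (A + (t : ℂ) • K).PosSemidef ∧ ¬ (A + (t : ℂ) • K).PosDef := by
  have hherm : ∀ t : ℝ, (A + (t : ℂ) • K).IsHermitian := fun t => by
    refine hA.isHermitian.add ?_
    rw [Matrix.IsHermitian, conjTranspose_smul, hK.eq]
    simp
  have hform : ∀ (t : ℝ) (v : ι → ℂ), (star v ⬝ᵥ ((A + (t : ℂ) • K) *ᵥ v)).re =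
      (star v ⬝ᵥ (A *ᵥ v)).re + t * (star v ⬝ᵥ (K *ᵥ v)).re := fun t v => by
    simp [add_mulVec, smul_mulVec, dotProduct_add, dotProduct_smul]
  have hiff : ∀ t : ℝ, (A + (t : ℂ) • K).PosSemidef ↔ ∀ v : ι → ℂ,
      0 ≤ (star v ⬝ᵥ (A *ᵥ v)).re + t * (star v ⬝ᵥ (K *ᵥ v)).re := fun t => by
    refine ⟨fun h v => ?_, fun h => .of_dotProduct_mulVec_nonneg (hherm t) fun v => ?_⟩
    · rw [← hform]
      exact (Complex.nonneg_iff.1 (h.dotProduct_mulVec_nonneg v)).1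
    · rw [Complex.nonneg_iff, hform]
      exact ⟨h v, ((hherm t).im_star_dotProduct_mulVec_self v).symm⟩
  set E : Set ℝ := {t | 0 ≤ t ∧ (A + (t : ℂ) • K).PosSemidef} with hE
  have h0 : (0 : ℝ) ∈ E := ⟨le_rfl, by simpa using hA.posSemidef⟩
  have hbdd : BddAbove E := by
    refine ⟨(star x ⬝ᵥ (A *ᵥ x)).re / -(star x ⬝ᵥ (K *ᵥ x)).re, fun t ht => ?_⟩
    have := (hiff t).1 ht.2 x
    rw [le_div_iff₀ (by linarith)]
    linarith
  have hclosed : IsClosed E := by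
    have : E = Set.Ici 0 ∩ ⋂ v : ι → ℂ,
        {t | 0 ≤ (star v ⬝ᵥ (A *ᵥ v)).re + t * (star v ⬝ᵥ (K *ᵥ v)).re} := by
      ext t
      rw [Set.mem_inter_iff, Set.mem_iInter]
      exact and_congr Iff.rfl (hiff t)
    rw [this]
    exact isClosed_Ici.inter (isClosed_iInter fun v =>
      isClosed_le continuous_const (by fun_prop))
  have hmem := hclosed.csSup_mem ⟨0, h0⟩ hbdd
  have hnot : ¬ (A + ((sSup E : ℝ) : ℂ) • K).PosDef := fun hpd => by
    obtain ⟨ε, hε, h⟩ := exists_pos_add_smul_posSemidef hpd hK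
    have : sSup E + ε ∈ E := by
      refine ⟨add_nonneg hmem.1 hε.le, ?_⟩
      rwa [Complex.ofReal_add, add_smul, ← add_assoc]
    linarith [le_csSup hbdd this]
  refine ⟨sSup E, lt_of_le_of_ne hmem.1 fun h => hnot ?_, hmem.2, hnot⟩
  rw [← h]
  simpa using hA

end Pencil

section Symplectic

open Matrix

variable {n : ℕ}

theorem stdJ_transpose : (stdJ n)ᵀ = -stdJ n := by
  simp [stdJ, fromBlocks_transpose, fromBlocks_neg]

theorem stdJ_mul_self : stdJ n * stdJ n = -1 := by
  rw [stdJ, fromBlocks_multiply, ← fromBlocks_one, fromBlocks_neg]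
  simp

/-- The complex Hermitian matrix `i J`. -/
def hermJ (n : ℕ) : Matrix (Fin n ⊕ Fin n) (Fin n ⊕ Fin n) ℂ :=
  Complex.I • (stdJ n).map Complex.ofReal

theorem hermJ_isHermitian : (hermJ n).IsHermitian := by
  have h : ((stdJ n).map Complex.ofReal)ᴴ = -(stdJ n).map Complex.ofReal := by
    have h := congrArg (fun M => M.map Complex.ofReal) (stdJ_transpose (n := n))
    ext i j
    have := congrFun (congrFun h i) j
    simpa [conjTranspose_apply] using this
  rw [Matrix.IsHermitian, hermJ, conjTranspose_smul, h]
  simp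

theorem uncertaintyMatrix_eq (S : Matrix (Fin n ⊕ Fin n) (Fin n ⊕ Fin n) ℝ) (η : ℝ) :
    uncertaintyMatrix S η = S.map Complex.ofReal + ((η / 2 : ℝ) : ℂ) • hermJ n := by
  rw [uncertaintyMatrix, hermJ, smul_smul]
  congr 2
  push_cast
  ring

theorem map_ofReal_isHermitian {S : Matrix (Fin n ⊕ Fin n) (Fin n ⊕ Fin n) ℝ}
    (hS : S.IsHermitian) : (S.map Complex.ofReal).IsHermitian := by
  ext i j
  have := congrFun (congrFun hS i) j
  simp only [conjTranspose_apply, map_apply, star_trivial] at this ⊢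
  rw [this]
  simp

theorem uncertaintyMatrix_isHermitian {S : Matrix (Fin n ⊕ Fin n) (Fin n ⊕ Fin n) ℝ}
    (hS : S.IsHermitian) (η : ℝ) : (uncertaintyMatrix S η).IsHermitian := by
  rw [uncertaintyMatrix_eq]
  refine (map_ofReal_isHermitian hS).add ?_
  rw [Matrix.IsHermitian, conjTranspose_smul, hermJ_isHermitian.eq]
  simp

theorem uncertaintyMatrix_neg {S : Matrix (Fin n ⊕ Fin n) (Fin n ⊕ Fin n) ℝ}
    (hS : S.IsHermitian) (η : ℝ) : uncertaintyMatrix S (-η) = (uncertaintyMatrix S η)ᵀ := by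
  ext i j
  have h1 := congrFun (congrFun hS i) j
  have h2 := congrFun (congrFun (stdJ_transpose (n := n)) i) j
  simp only [conjTranspose_apply, star_trivial, transpose_apply, Matrix.neg_apply] at h1 h2
  simp only [uncertaintyMatrix, Matrix.add_apply, Matrix.smul_apply, map_apply, transpose_apply,
    smul_eq_mul, h1, h2]
  push_cast
  ring

theorem re_quadForm_map (S : Matrix (Fin n ⊕ Fin n) (Fin n ⊕ Fin n) ℝ)
    (v : Fin n ⊕ Fin n → ℂ) :
    (star v ⬝ᵥ (S.map Complex.ofReal *ᵥ v)).re =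
      (fun i => (v i).re) ⬝ᵥ (S *ᵥ fun i => (v i).re) +
        (fun i => (v i).im) ⬝ᵥ (S *ᵥ fun i => (v i).im) := by
  simp only [dotProduct, mulVec, Pi.star_apply, map_apply, Finset.mul_sum, Complex.re_sum,
    ← Finset.sum_add_distrib]
  refine Finset.sum_congr rfl fun i _ => Finset.sum_congr rfl fun j _ => ?_
  simp [Complex.mul_re, Complex.mul_im]

theorem re_quadForm_hermJ (v : Fin n ⊕ Fin n → ℂ) :
    (star v ⬝ᵥ (hermJ n *ᵥ v)).re =
      -2 * ((fun i => (v i).re) ⬝ᵥ (stdJ n *ᵥ fun i => (v i).im)) := by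
  have hv : (star v ⬝ᵥ (hermJ n *ᵥ v)).re =
      (fun i => (v i).im) ⬝ᵥ (stdJ n *ᵥ fun i => (v i).re) -
        (fun i => (v i).re) ⬝ᵥ (stdJ n *ᵥ fun i => (v i).im) := by
    simp only [hermJ, dotProduct, mulVec, Pi.star_apply, map_apply, Finset.mul_sum, Complex.re_sum,
      ← Finset.sum_sub_distrib, Matrix.smul_apply, smul_eq_mul]
    refine Finset.sum_congr rfl fun i _ => Finset.sum_congr rfl fun j _ => ?_
    simp [Complex.mul_re, Complex.mul_im]
    ring
  have hanti : (fun i => (v i).im) ⬝ᵥ (stdJ n *ᵥ fun i => (v i).re) =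
      -((fun i => (v i).re) ⬝ᵥ (stdJ n *ᵥ fun i => (v i).im)) := by
    rw [dotProduct_mulVec, ← mulVec_transpose, stdJ_transpose, neg_mulVec, neg_dotProduct,
      dotProduct_comm]
  rw [hv, hanti]
  ring

theorem map_ofReal_posDef {S : Matrix (Fin n ⊕ Fin n) (Fin n ⊕ Fin n) ℝ} (hS : S.PosDef) :
    (S.map Complex.ofReal).PosDef := by
  refine .of_dotProduct_mulVec_pos (map_ofReal_isHermitian hS.isHermitian) fun v hv => ?_
  rw [Complex.lt_def, re_quadForm_map]
  refine ⟨?_, ((map_ofReal_isHermitian hS.isHermitian).im_star_dotProduct_mulVec_self v).symm⟩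
  have hn : ∀ u : Fin n ⊕ Fin n → ℝ, 0 ≤ u ⬝ᵥ (S *ᵥ u) := fun u => by
    simpa using hS.posSemidef.dotProduct_mulVec_nonneg u
  have hp : ∀ u : Fin n ⊕ Fin n → ℝ, u ≠ 0 → 0 < u ⬝ᵥ (S *ᵥ u) := fun u hu => by
    simpa using hS.dotProduct_mulVec_pos hu
  by_cases hre : (fun i => (v i).re) = 0
  · have him : (fun i => (v i).im) ≠ 0 := fun him => hv <| funext fun i =>
      Complex.ext (congrFun hre i) (congrFun him i)
    exact add_pos_of_nonneg_of_pos (hn _) (hp _ him)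
  · exact add_pos_of_pos_of_nonneg (hp _ hre) (hn _)

/-- The `i l` eigenspace of `S J` is carried by `J` onto the kernel of `S + i l J`. -/
theorem mem_symplecticEigenvalues_iff (S : Matrix (Fin n ⊕ Fin n) (Fin n ⊕ Fin n) ℝ) {l : ℝ}
    (hl : 0 < l) :
    l ∈ symplecticEigenvalues S ↔
      ∃ v : Fin n ⊕ Fin n → ℂ, v ≠ 0 ∧ (S.map Complex.ofReal + (l : ℂ) • hermJ n) *ᵥ v = 0 := by
  set A := S.map Complex.ofReal
  set J := (stdJ n).map Complex.ofReal 
  have hJJ : J * J = -1 := by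
    have h : (stdJ n * stdJ n).map Complex.ofReal = J * J :=
      Matrix.map_mul (f := Complex.ofRealHom)
    rw [← h, stdJ_mul_self]
    ext i j
    by_cases hij : i = j <;> simp [hij]
  have hSJ : (S * stdJ n).map Complex.ofReal = A * J := Matrix.map_mul (f := Complex.ofRealHom)
  have hJv : ∀ v, J *ᵥ (J *ᵥ v) = -v := fun v => by
    rw [mulVec_mulVec, hJJ, neg_mulVec, one_mulVec]
  simp only [symplecticEigenvalues, Set.mem_ofPred_eq, hl, true_and, hSJ]
  have hadd : ∀ v, (A + (l : ℂ) • hermJ n) *ᵥ v =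
      A *ᵥ v + ((l : ℂ) * Complex.I) • (J *ᵥ v) := fun v => by
    rw [add_mulVec, hermJ, smul_smul, smul_mulVec]
  constructor
  · intro h
    obtain ⟨w, hw⟩ := h.exists_hasEigenvector
    have h1 : A *ᵥ (J *ᵥ w) = (Complex.I * (l : ℂ)) • w := by
      simpa using hw.apply_eq_smul
    refine ⟨J *ᵥ w, fun h0 => hw.2 ?_, ?_⟩
    · have := hJv w
      rw [h0, mulVec_zero] at this
      simpa using this.symm
    · rw [hadd, hJv, h1, mul_comm]
      simp
  · rintro ⟨v, hv, h⟩
    refine Module.End.hasEigenvalue_of_hasEigenvector (x := J *ᵥ v) ⟨?_, fun h0 => hv ?_⟩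
    · rw [Module.End.mem_eigenspace_iff, toLin'_apply, ← mulVec_mulVec, hJv, mulVec_neg]
      rw [hadd] at h
      rw [eq_neg_of_add_eq_zero_left h, neg_neg, mul_comm]
    · have := hJv v
      rw [h0, mulVec_zero] at this
      simpa using this.symm

/-- The smallest symplectic eigenvalue `l` of `S` exists, and `[-2l, 2l]` is the set of values of
Planck's constant admitted by the uncertainty principle for `S`. -/
theorem exists_isLeast_symplecticEigenvalues (hn : 1 ≤ n)
    {S : Matrix (Fin n ⊕ Fin n) (Fin n ⊕ Fin n) ℝ} (hS : S.PosDef) :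
    ∃ l : ℝ, IsLeast (symplecticEigenvalues S) l ∧
      ∀ η : ℝ, (uncertaintyMatrix S η).PosSemidef ↔ |η| ≤ 2 * l := by
  have hA := map_ofReal_posDef hS
  obtain ⟨x, hx⟩ : ∃ x : Fin n ⊕ Fin n → ℂ, (star x ⬝ᵥ (hermJ n *ᵥ x)).re < 0 := by
    -- `x = e + i f` for a conjugate pair `e`, `f` of coordinate directions
    have i₀ : Fin n := ⟨0, hn⟩
    refine ⟨Sum.elim (Pi.single i₀ 1) (Pi.single i₀ Complex.I), ?_⟩
    rw [re_quadForm_hermJ]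
    have h1 : (fun i => ((Sum.elim (Pi.single i₀ 1) (Pi.single i₀ Complex.I) :
        Fin n ⊕ Fin n → ℂ) i).re) = Sum.elim (Pi.single i₀ 1) 0 := by
      ext (i | i) <;> by_cases h : i = i₀ <;> simp [h]
    have h2 : (fun i => ((Sum.elim (Pi.single i₀ 1) (Pi.single i₀ Complex.I) :
        Fin n ⊕ Fin n → ℂ) i).im) = Sum.elim (0 : Fin n → ℝ) (Pi.single i₀ 1) := by
      ext (i | i) <;> by_cases h : i = i₀ <;> simp [h]
    rw [h1, h2, stdJ, fromBlocks_mulVec]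
    simp
  obtain ⟨t, ht, hpsd, hnpd⟩ := exists_posSemidef_not_posDef hA hermJ_isHermitian hx
  have hker : ∃ v, v ≠ 0 ∧ (S.map Complex.ofReal + (t : ℂ) • hermJ n) *ᵥ v = 0 := by
    rw [hpsd.posDef_iff_det_ne_zero, not_not] at hnpd
    exact exists_mulVec_eq_zero_iff.2 hnpd
  -- a kernel vector at parameter `l` bounds every admissible parameter by `l`
  have hle : ∀ {l s : ℝ} {v : Fin n ⊕ Fin n → ℂ}, 0 < l → v ≠ 0 →
      (S.map Complex.ofReal + (l : ℂ) • hermJ n) *ᵥ v = 0 →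
      (S.map Complex.ofReal + (s : ℂ) • hermJ n).PosSemidef → s ≤ l := by
    intro l s v hl hv h0 hs
    have h1 := (Complex.lt_def.1 (hA.dotProduct_mulVec_pos hv)).1
    have h2 := (Complex.nonneg_iff.1 (hs.dotProduct_mulVec_nonneg v)).1
    have h3 := congrArg (fun w => (star v ⬝ᵥ w).re) h0
    simp only [add_mulVec, smul_mulVec, dotProduct_add, dotProduct_smul, smul_eq_mul,
      Complex.add_re, Complex.re_ofReal_mul, dotProduct_zero, Complex.zero_re] at h1 h2 h3
    by_contra! hlt
    nlinarith
  have habs : ∀ η : ℝ, (uncertaintyMatrix S η).PosSemidef ↔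
      (uncertaintyMatrix S |η|).PosSemidef := fun η => by
    rcases abs_choice η with h | h
    · rw [h]
    · rw [h, uncertaintyMatrix_neg hS.isHermitian, posSemidef_transpose_iff]
  refine ⟨t, ⟨(mem_symplecticEigenvalues_iff S ht).2 hker, fun l hl => ?_⟩, fun η => ?_⟩
  · obtain ⟨v, hv, h0⟩ := (mem_symplecticEigenvalues_iff S hl.1).1 hl
    exact hle hl.1 hv h0 hpsd
  · rw [habs, uncertaintyMatrix_eq]
    constructor
    · intro h
      obtain ⟨v, hv, h0⟩ := hker
      linarith [hle ht hv h0 h]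
    · intro h
      have h1 : |η| / 2 / t ≤ 1 := by
        rw [div_le_one ht]
        linarith
      have h2 : (0 : ℝ) ≤ |η| / 2 / t := by positivity
      have h3 : S.map Complex.ofReal + ((|η| / 2 : ℝ) : ℂ) • hermJ n =
          ((1 - |η| / 2 / t : ℝ) : ℂ) • S.map Complex.ofReal +
            ((|η| / 2 / t : ℝ) : ℂ) • (S.map Complex.ofReal + (t : ℂ) • hermJ n) := by
        rw [smul_add, smul_smul, ← add_assoc, ← add_smul, ← Complex.ofReal_add,
          ← Complex.ofReal_mul, div_mul_cancel₀ _ ht.ne']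
        simp
      rw [h3]
      exact (hA.posSemidef.smul (by exact_mod_cast sub_nonneg.2 h1)).add
        (hpsd.smul (by exact_mod_cast h2))

end Symplectic

/-! ### The two-point function of a wave function -/

section TwoPoint

open Filter Topology

variable {n : ℕ}

/-- The two-point function `ψ(x + y/2) ψ*(x - y/2)`, whose Fourier transform in `y` is the Wigner
transform of `ψ` and whose Fourier transform in `x` is the ambiguity function of `ψ`. -/
def twoPoint (ψ : StateSpace n) (x y : Config n) : ℂ :=
  ψ (x + (1 / 2 : ℝ) • y) * starRingEnd ℂ (ψ (x - (1 / 2 : ℝ) • y))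

/-- The ambiguity function `∫ exp (i a·x) ψ(x + y/2) ψ*(x - y/2) dx` of `ψ`; it is the expectation
of a Weyl translation operator in the state `ψ`. -/
def ambiguity (ψ : StateSpace n) (a y : Config n) : ℂ :=
  ∫ x : Config n, Complex.exp (Complex.I * ((inner ℝ a x : ℝ) : ℂ)) * twoPoint ψ x y

theorem integrable_norm_sq (ψ : StateSpace n) : Integrable fun x : Config n => ‖ψ x‖ ^ 2 :=
  (memLp_two_iff_integrable_sq_norm (Lp.aestronglyMeasurable ψ)).1 (Lp.memLp ψ)

theorem integral_norm_sq (ψ : StateSpace n) : ∫ x : Config n, ‖ψ x‖ ^ 2 = ‖ψ‖ ^ 2 := by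
  have h := L2.inner_def (𝕜 := ℂ) ψ ψ
  simp only [inner_self_eq_norm_sq_to_K] at h
  have h2 : ((‖ψ‖ ^ 2 : ℝ) : ℂ) = ((∫ x : Config n, ‖ψ x‖ ^ 2 : ℝ) : ℂ) := by
    rw [← integral_complex_ofReal]
    simpa using h
  exact_mod_cast h2.symm

theorem stronglyMeasurable_twoPoint (ψ : StateSpace n) :
    StronglyMeasurable fun z : Config n × Config n => twoPoint ψ z.1 z.2 := by
  have h := Lp.stronglyMeasurable ψ
  refine (h.comp_measurable (g := fun z : Config n × Config n => z.1 + (1 / 2 : ℝ) • z.2)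
    (by fun_prop)).mul ?_
  exact Complex.continuous_conj.comp_stronglyMeasurable
    (h.comp_measurable (g := fun z : Config n × Config n => z.1 - (1 / 2 : ℝ) • z.2)
    (by fun_prop))

theorem norm_twoPoint_le (ψ : StateSpace n) (x y : Config n) :
    ‖twoPoint ψ x y‖ ≤ (‖ψ (x + (1 / 2 : ℝ) • y)‖ ^ 2 + ‖ψ (x - (1 / 2 : ℝ) • y)‖ ^ 2) / 2 := by
  rw [twoPoint, norm_mul, RCLike.norm_conj]
  linarith [two_mul_le_add_sq ‖ψ (x + (1 / 2 : ℝ) • y)‖ ‖ψ (x - (1 / 2 : ℝ) • y)‖]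

theorem integrable_twoPoint_left (ψ : StateSpace n) (y : Config n) :
    Integrable fun x => twoPoint ψ x y := by
  have h := integrable_norm_sq ψ
  refine Integrable.mono' (((h.comp_add_right ((1 / 2 : ℝ) • y)).add
    (h.comp_sub_right ((1 / 2 : ℝ) • y))).div_const 2)
    ((stronglyMeasurable_twoPoint ψ).comp_measurable
      (measurable_id.prodMk measurable_const)).aestronglyMeasurable
    (.of_forall fun x => norm_twoPoint_le ψ x y)

theorem integral_norm_twoPoint_left_le (ψ : StateSpace n) (y : Config n) :
    ∫ x, ‖twoPoint ψ x y‖ ≤ ‖ψ‖ ^ 2 := by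
  have h := integrable_norm_sq ψ
  refine (integral_mono (integrable_twoPoint_left ψ y).norm
    (((h.comp_add_right ((1 / 2 : ℝ) • y)).add
    (h.comp_sub_right ((1 / 2 : ℝ) • y))).div_const 2)
    (fun x => norm_twoPoint_le ψ x y)).trans_eq ?_
  simp only [Pi.add_apply]
  rw [integral_div, integral_add (h.comp_add_right _) (h.comp_sub_right _),
    integral_add_right_eq_self (fun x => ‖ψ x‖ ^ 2),
    integral_sub_right_eq_self (fun x => ‖ψ x‖ ^ 2), integral_norm_sq]
  ring

theorem integrable_twoPoint_right (ψ : StateSpace n) (x : Config n) :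
    Integrable fun y => twoPoint ψ x y := by
  have h := integrable_norm_sq ψ
  refine Integrable.mono'
    ((((integrable_comp_smul_iff volume _ (by norm_num : (1 / 2 : ℝ) ≠ 0)).2
      (h.comp_add_left x)).add
    ((integrable_comp_smul_iff volume _ (by norm_num : (1 / 2 : ℝ) ≠ 0)).2
      (h.comp_sub_left x))).div_const 2)
    ((stronglyMeasurable_twoPoint ψ).comp_measurable
      (measurable_const.prodMk measurable_id)).aestronglyMeasurable
    (.of_forall fun y => norm_twoPoint_le ψ x y)

theorem integral_norm_twoPoint_right_le (ψ : StateSpace n) (x : Config n) :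
    ∫ y, ‖twoPoint ψ x y‖ ≤ 2 ^ n * ‖ψ‖ ^ 2 := by
  have h := integrable_norm_sq ψ
  have h1 := (integrable_comp_smul_iff volume _ (by norm_num : (1 / 2 : ℝ) ≠ 0)).2
      (h.comp_add_left x)
  have h2 := (integrable_comp_smul_iff volume _ (by norm_num : (1 / 2 : ℝ) ≠ 0)).2
      (h.comp_sub_left x)
  refine (integral_mono (integrable_twoPoint_right ψ x).norm ((h1.add h2).div_const 2)
    (fun y => norm_twoPoint_le ψ x y)).trans_eq ?_
  simp only [Pi.add_apply]
  rw [integral_div, integral_add h1 h2,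
    Measure.integral_comp_smul volume (fun y => ‖ψ (x + y)‖ ^ 2),
    Measure.integral_comp_smul volume (fun y => ‖ψ (x - y)‖ ^ 2),
    integral_add_left_eq_self (fun y => ‖ψ y‖ ^ 2),
    integral_sub_left_eq_self (fun y => ‖ψ y‖ ^ 2), integral_norm_sq]
  simp

theorem wigner_eq (η : ℝ) (ψ : StateSpace n) (z : Phase n) :
    wigner η ψ z = (((1 / (2 * Real.pi * |η|)) ^ n : ℝ) : ℂ) *
      ∫ y : Config n, Complex.exp (-(Complex.I / (η : ℂ)) * ((inner ℝ z.2 y : ℝ) : ℂ)) *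
        twoPoint ψ z.1 y := by
  simp only [wigner, twoPoint, mul_assoc]

theorem norm_exp_neg_I_div_mul (η s : ℝ) :
    ‖Complex.exp (-(Complex.I / (η : ℂ)) * (s : ℂ))‖ = 1 := by
  rw [show -(Complex.I / (η : ℂ)) * (s : ℂ) = ((-(s / η) : ℝ) : ℂ) * Complex.I by
    push_cast; ring, Complex.norm_exp_ofReal_mul_I]

theorem norm_exp_I_mul (s : ℝ) : ‖Complex.exp (Complex.I * (s : ℂ))‖ = 1 := by
  rw [mul_comm, Complex.norm_exp_ofReal_mul_I]

/-- The Wigner transform of a square integrable function is bounded. -/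
theorem norm_wigner_le (η : ℝ) (ψ : StateSpace n) (z : Phase n) :
    ‖wigner η ψ z‖ ≤ (1 / (2 * Real.pi * |η|)) ^ n * (2 ^ n * ‖ψ‖ ^ 2) := by
  rw [wigner_eq, norm_mul, Complex.norm_real, Real.norm_of_nonneg (by positivity)]
  refine mul_le_mul_of_nonneg_left ?_ (by positivity)
  refine (norm_integral_le_integral_norm _).trans ?_
  simp only [norm_mul, norm_exp_neg_I_div_mul, one_mul]
  exact integral_norm_twoPoint_right_le ψ z.1

theorem stronglyMeasurable_wigner (η : ℝ) (ψ : StateSpace n) :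
    StronglyMeasurable fun z : Phase n => wigner η ψ z := by
  simp only [wigner_eq]
  refine StronglyMeasurable.const_mul ?_ _
  refine StronglyMeasurable.integral_prod_right
    (f := fun (z : Phase n) (y : Config n) =>
      Complex.exp (-(Complex.I / (η : ℂ)) * ((inner ℝ z.2 y : ℝ) : ℂ)) * twoPoint ψ z.1 y) ?_
  refine StronglyMeasurable.mul (Continuous.stronglyMeasurable ?_)
    ((stronglyMeasurable_twoPoint ψ).comp_measurable
      (g := fun w : Phase n × Config n => (w.1.1, w.2)) (by fun_prop))
  fun_prop

/-- The form in which the continuity of the translation action on `L²` asks for `2 ≠ ∞`. -/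
instance : Fact ((2 : ENNReal) ≠ ⊤) := ⟨ENNReal.ofNat_ne_top⟩

/-- The product `z w*` as a real bilinear map. -/
def mulConj : ℂ →L[ℝ] ℂ →L[ℝ] ℂ :=
  (ContinuousLinearMap.mul ℝ ℂ).bilinearComp (.id ℝ ℂ) (Complex.conjCLE : ℂ →L[ℝ] ℂ)

/-- The two-point function at fixed `y`, as an element of `L¹`. -/
def twoPointL1 (ψ : StateSpace n) (y : Config n) : Lp ℂ 1 (volume : Measure (Config n)) :=
  mulConj.holderL volume 2 2 1 (DomAddAct.mk ((1 / 2 : ℝ) • y) +ᵥ ψ)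
    (DomAddAct.mk (-((1 / 2 : ℝ) • y)) +ᵥ ψ)

theorem continuous_twoPointL1 (ψ : StateSpace n) : Continuous (twoPointL1 ψ) := by
  have h : Continuous fun y : Config n => (DomAddAct.mk y +ᵥ ψ : StateSpace n) :=
    (DomAddAct.continuous_mk).vadd continuous_const
  have h1 : Continuous fun y : Config n =>
      (DomAddAct.mk ((1 / 2 : ℝ) • y) +ᵥ ψ : StateSpace n) :=
    h.comp (continuous_const_smul (1 / 2 : ℝ))
  have h2 : Continuous fun y : Config n =>
      (DomAddAct.mk (-((1 / 2 : ℝ) • y)) +ᵥ ψ : StateSpace n) :=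
    h.comp (continuous_const_smul (1 / 2 : ℝ)).neg
  exact ((mulConj.holderL volume 2 2 1).continuous.comp h1).clm_apply h2

theorem coeFn_twoPointL1 (ψ : StateSpace n) (y : Config n) :
    twoPointL1 ψ y =ᵐ[volume] fun x => twoPoint ψ x y := by
  have h1 := DomAddAct.vadd_Lp_ae_eq (DomAddAct.mk ((1 / 2 : ℝ) • y)) ψ
  have h2 := DomAddAct.vadd_Lp_ae_eq (DomAddAct.mk (-((1 / 2 : ℝ) • y))) ψ
  have h3 := mulConj.coeFn_holder (r := 1) (DomAddAct.mk ((1 / 2 : ℝ) • y) +ᵥ ψ)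
    (DomAddAct.mk (-((1 / 2 : ℝ) • y)) +ᵥ ψ)
  filter_upwards [h1, h2, h3] with x h1 h2 h3
  refine h3.trans ?_
  rw [h1, h2, twoPoint, add_comm x, sub_eq_neg_add]
  rfl

/-- Joint continuity of `(m, y) ↦ ∫ m(x) ψ(x + y/2) ψ*(x - y/2) dx` along bounded, pointwise
convergent multipliers `m`; this rests on the continuity of translations in `L²`. -/
theorem tendsto_integral_mul_twoPoint {ι : Type*} {l : Filter ι} [l.IsCountablyGenerated]
    (ψ : StateSpace n) {m : ι → Config n → ℂ} {m₀ : Config n → ℂ} {y : ι → Config n}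
    {y₀ : Config n} (hm : ∀ i, Continuous (m i)) (hm1 : ∀ i x, ‖m i x‖ ≤ 1)
    (hlim : ∀ x, Tendsto (fun i => m i x) l (𝓝 (m₀ x))) (hy : Tendsto y l (𝓝 y₀)) :
    Tendsto (fun i => ∫ x, m i x * twoPoint ψ x (y i)) l (𝓝 (∫ x, m₀ x * twoPoint ψ x y₀)) := by
  have hint : ∀ i y, Integrable fun x => m i x * twoPoint ψ x y := fun i y =>
    (integrable_twoPoint_left ψ y).bdd_mul (hm i).aestronglyMeasurable (.of_forall (hm1 i))
  have hfix : Tendsto (fun i => ∫ x, m i x * twoPoint ψ x y₀) l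
      (𝓝 (∫ x, m₀ x * twoPoint ψ x y₀)) := by
    refine tendsto_integral_filter_of_dominated_convergence (fun x => ‖twoPoint ψ x y₀‖)
      (.of_forall fun i => (hint i y₀).aestronglyMeasurable)
      (.of_forall fun i => .of_forall fun x => ?_) (integrable_twoPoint_left ψ y₀).norm
      (.of_forall fun x => (hlim x).mul_const _)
    rw [norm_mul]
    exact mul_le_of_le_one_left (norm_nonneg _) (hm1 i x)
  have hdiff : Tendsto (fun i => ∫ x, m i x * twoPoint ψ x (y i) - m i x * twoPoint ψ x y₀) l
      (𝓝 0) := by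
    have hL : Tendsto (fun i => ‖twoPointL1 ψ (y i) - twoPointL1 ψ y₀‖) l (𝓝 0) := by
      have := (((continuous_twoPointL1 ψ).tendsto y₀).comp hy).sub_const (twoPointL1 ψ y₀)
      simpa using this.norm
    refine squeeze_zero_norm (fun i => ?_) hL
    refine (norm_integral_le_integral_norm _).trans ?_
    rw [L1.norm_eq_integral_norm]
    refine integral_mono_ae ((hint i _).sub (hint i _)).norm
      (L1.integrable_coeFn _).norm ?_
    filter_upwards [coeFn_twoPointL1 ψ (y i), coeFn_twoPointL1 ψ y₀,
      Lp.coeFn_sub (twoPointL1 ψ (y i)) (twoPointL1 ψ y₀)] with x h1 h2 h3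
    rw [h3, Pi.sub_apply, h1, h2, ← mul_sub, norm_mul]
    exact mul_le_of_le_one_left (norm_nonneg _) (hm1 i x)
  have := hdiff.add hfix
  rw [zero_add] at this
  refine this.congr fun i => ?_
  rw [integral_sub (hint i _) (hint i _), sub_add_cancel]

end TwoPoint

/-! ### The characteristic function of a Wigner transform -/

section Characteristic

open Filter Topology

variable {n : ℕ}

/-- The plane wave `exp (i a·x)` with a Gaussian cutoff `exp (-ε |x|²)`. -/
def dampedWave (ε : ℝ) (a x : Config n) : ℂ :=
  Complex.exp (-(ε : ℂ) * (‖x‖ : ℂ) ^ 2 + Complex.I * ((inner ℝ a x : ℝ) : ℂ))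

theorem continuous_dampedWave (ε : ℝ) (a : Config n) : Continuous (dampedWave ε a) := by
  unfold dampedWave
  fun_prop

theorem norm_dampedWave (ε : ℝ) (a x : Config n) :
    ‖dampedWave ε a x‖ = Real.exp (-ε * ‖x‖ ^ 2) := by
  rw [dampedWave, Complex.exp_add, norm_mul, norm_exp_I_mul, mul_one, Complex.norm_exp]
  norm_cast

theorem norm_dampedWave_le {ε : ℝ} (hε : 0 ≤ ε) (a x : Config n) : ‖dampedWave ε a x‖ ≤ 1 := by
  rw [norm_dampedWave, Real.exp_le_one_iff, neg_mul]
  exact neg_nonpos.2 (by positivity)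

theorem integrable_dampedWave {ε : ℝ} (hε : 0 < ε) (a : Config n) :
    Integrable (dampedWave ε a) :=
  GaussianFourier.integrable_cexp_neg_mul_sq_norm_add (b := (ε : ℂ)) (by simpa using hε)
    Complex.I a

theorem integrable_exp_neg_norm_sq : Integrable fun u : Config n => Real.exp (-‖u‖ ^ 2) := by
  refine (integrable_dampedWave one_pos (0 : Config n)).norm.congr (.of_forall fun u => ?_)
  simp [norm_dampedWave]

theorem tendsto_dampedWave (a x : Config n) :
    Tendsto (fun s : ℝ => dampedWave (s ^ 2) a x) (𝓝[>] 0)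
      (𝓝 (Complex.exp (Complex.I * ((inner ℝ a x : ℝ) : ℂ)))) := by
  have h : Continuous fun s : ℝ => dampedWave (s ^ 2) a x := by
    unfold dampedWave
    fun_prop
  have := (h.tendsto 0).mono_left (nhdsWithin_le_nhds (s := Set.Ioi 0))
  simpa [dampedWave] using this

/-- The Fourier transform in `p` of the cutoff is a Gaussian concentrated near `y = η b`. -/
theorem integral_dampedWave_mul_exp {η : ℝ} (hη : η ≠ 0) {s : ℝ} (hs : 0 < s)
    (b u : Config n) :
    ∫ p : Config n, dampedWave (s ^ 2) b p *
      Complex.exp (-(Complex.I / (η : ℂ)) * ((inner ℝ p (η • b + (2 * η * s) • u) : ℝ) : ℂ)) =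
    (((√Real.pi / s) ^ n : ℝ) : ℂ) * (Real.exp (-‖u‖ ^ 2) : ℂ) := by
  have hηc : (η : ℂ) ≠ 0 := by exact_mod_cast hη
  have hsc : (s : ℂ) ≠ 0 := by exact_mod_cast hs.ne'
  have h := GaussianFourier.integral_cexp_neg_mul_sq_norm_add (V := Config n)
    (b := ((s ^ 2 : ℝ) : ℂ)) (by rw [Complex.ofReal_re]; positivity) Complex.I (-(2 * s) • u)
  have h1 : ∀ p : Config n, dampedWave (s ^ 2) b p *
      Complex.exp (-(Complex.I / (η : ℂ)) * ((inner ℝ p (η • b + (2 * η * s) • u) : ℝ) : ℂ)) =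
      Complex.exp (-((s ^ 2 : ℝ) : ℂ) * ‖p‖ ^ 2 +
        Complex.I * ((inner ℝ (-(2 * s) • u) p : ℝ) : ℂ)) := fun p => by
    rw [dampedWave, ← Complex.exp_add, inner_add_right, inner_smul_right, inner_smul_right,
      inner_smul_left, real_inner_comm b p, real_inner_comm u p]
    congr 1
    push_cast
    simp only [conj_trivial]
    push_cast
    field_simp
    ring
  simp only [h1, h, finrank_euclideanSpace, Fintype.card_fin]
  congr 1
  · have h2 : (Real.pi / s ^ 2 : ℝ) = (√Real.pi / s) ^ 2 := by
      rw [div_pow, Real.sq_sqrt Real.pi_pos.le]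
    rw [← Complex.ofReal_div, h2, Complex.ofReal_pow, ← Complex.cpow_nat_mul']
    · have : (((2 : ℕ) : ℂ) * ((n : ℂ) / 2)) = n := by push_cast; ring
      rw [this, Complex.cpow_natCast]
      norm_cast
    · rw [Complex.arg_ofReal_of_nonneg (by positivity)]
      simpa using Real.pi_pos
    · rw [Complex.arg_ofReal_of_nonneg (by positivity)]
      simpa using Real.pi_pos.le
  · rw [Complex.ofReal_exp, norm_smul, Complex.I_sq]
    congr 1
    rw [norm_neg, Real.norm_of_nonneg (by positivity : 0 ≤ 2 * s)]
    push_cast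
    field_simp
    ring

/-- The Gaussian regularization of `∫ exp (i (a·x + b·p)) W_η ψ(x, p) dx dp` is a Gaussian average
of regularized ambiguity functions at points near `η b`. -/
theorem integral_dampedWave_mul_wigner {η : ℝ} (hη : η ≠ 0) {s : ℝ} (hs : 0 < s)
    (ψ : StateSpace n) (a b : Config n) :
    ∫ z : Phase n, dampedWave (s ^ 2) a z.1 * dampedWave (s ^ 2) b z.2 * wigner η ψ z =
      (((√Real.pi ^ n)⁻¹ : ℝ) : ℂ) * ∫ u : Config n, (Real.exp (-‖u‖ ^ 2) : ℂ) *
        ∫ x, dampedWave (s ^ 2) a x * twoPoint ψ x (η • b + (2 * η * s) • u) := by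
  have hs2 : (0 : ℝ) < s ^ 2 := by positivity
  set c : ℂ := (((1 / (2 * Real.pi * |η|)) ^ n : ℝ) : ℂ) with hc
  set e : Config n → Config n → ℂ := fun p y =>
    Complex.exp (-(Complex.I / (η : ℂ)) * ((inner ℝ p y : ℝ) : ℂ)) with he
  have hecont : Continuous fun w : Config n × Config n => e w.1 w.2 := by
    rw [he]
    fun_prop
  set h : Config n → ℂ := fun y => ∫ p, dampedWave (s ^ 2) b p * e p y with hh
  have hint : Integrable fun z : Phase n =>
      dampedWave (s ^ 2) a z.1 * dampedWave (s ^ 2) b z.2 * wigner η ψ z := by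
    exact ((integrable_dampedWave hs2 a).mul_prod (integrable_dampedWave hs2 b)).mul_bdd
      (stronglyMeasurable_wigner η ψ).aestronglyMeasurable
      (.of_forall fun z => norm_wigner_le η ψ z)
  have hp : ∀ x : Config n, ∫ p, dampedWave (s ^ 2) b p * wigner η ψ (x, p) =
      c * ∫ y, h y * twoPoint ψ x y := fun x => by
    have hI : Integrable (Function.uncurry fun p y : Config n =>
        dampedWave (s ^ 2) b p * (e p y * twoPoint ψ x y)) (volume.prod volume) := by
      have := ((integrable_dampedWave hs2 b).mul_prod (integrable_twoPoint_right ψ x)).bdd_mul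
        (c := 1) hecont.aestronglyMeasurable
        (.of_forall fun w => (norm_exp_neg_I_div_mul η _).le)
      refine this.congr (.of_forall fun w => ?_)
      simp only [Function.uncurry]
      ring
    calc ∫ p, dampedWave (s ^ 2) b p * wigner η ψ (x, p)
        = ∫ p, c * ∫ y, dampedWave (s ^ 2) b p * (e p y * twoPoint ψ x y) := by
          refine integral_congr_ae (.of_forall fun p => ?_)
          simp only [wigner_eq, integral_const_mul]
          ring
      _ = c * ∫ y, ∫ p, dampedWave (s ^ 2) b p * (e p y * twoPoint ψ x y) := by
          rw [integral_const_mul, integral_integral_swap hI]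
      _ = c * ∫ y, h y * twoPoint ψ x y := by
          simp only [hh, ← integral_mul_const, mul_assoc]
  have hk : 2 * η * s ≠ 0 := mul_ne_zero (mul_ne_zero two_ne_zero hη) hs.ne'
  have hsub : ∀ f : Config n → ℂ,
      ∫ y, f y = ((|2 * η * s| ^ n : ℝ) : ℂ) * ∫ u, f (η • b + (2 * η * s) • u) := fun f => by
    rw [Measure.integral_comp_smul volume (fun u => f (η • b + u)), finrank_euclideanSpace,
      Fintype.card_fin, integral_add_left_eq_self f, Complex.real_smul, ← mul_assoc,
      ← Complex.ofReal_mul, abs_inv, abs_pow, mul_inv_cancel₀ (by positivity), Complex.ofReal_one,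
      one_mul]
  have hhu : ∀ u, h (η • b + (2 * η * s) • u) =
      (((√Real.pi / s) ^ n : ℝ) : ℂ) * (Real.exp (-‖u‖ ^ 2) : ℂ) :=
    fun u => integral_dampedWave_mul_exp hη hs b u
  have hhm : StronglyMeasurable h := by
    refine StronglyMeasurable.integral_prod_left
      (f := fun (p y : Config n) => dampedWave (s ^ 2) b p * e p y) ?_
    exact (((continuous_dampedWave _ b).comp continuous_fst).mul hecont).stronglyMeasurable
  have hhint : Integrable h := by
    have h1 : Integrable fun u => h (η • b + (2 * η * s) • u) := by
      simp only [hhu]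
      exact integrable_exp_neg_norm_sq.ofReal.const_mul _
    have h2 := (integrable_comp_smul_iff volume (fun u => h (η • b + u)) hk).1 h1
    simpa using h2.comp_add_left (-(η • b))
  have hIxy : Integrable (Function.uncurry fun x y : Config n =>
      dampedWave (s ^ 2) a x * (h y * twoPoint ψ x y)) (volume.prod volume) := by
    have hmeas : AEStronglyMeasurable (Function.uncurry fun x y : Config n =>
        dampedWave (s ^ 2) a x * (h y * twoPoint ψ x y)) (volume.prod volume) :=
      (((continuous_dampedWave _ a).stronglyMeasurable.comp_measurable measurable_fst).mul
        ((hhm.comp_measurable measurable_snd).mul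
          (stronglyMeasurable_twoPoint ψ))).aestronglyMeasurable
    have hx : ∀ y, Integrable fun x => dampedWave (s ^ 2) a x * (h y * twoPoint ψ x y) := fun y =>
      ((integrable_twoPoint_left ψ y).const_mul _).bdd_mul
        (continuous_dampedWave _ a).aestronglyMeasurable
        (.of_forall (norm_dampedWave_le hs2.le a))
    refine (integrable_prod_iff' hmeas).2 ⟨.of_forall hx, ?_⟩
    refine (hhint.norm.mul_const (‖ψ‖ ^ 2)).mono' ?_ (.of_forall fun y => ?_)
    · exact hmeas.norm.prod_swap.integral_prod_right'
    · rw [Real.norm_of_nonneg (by positivity)]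
      calc ∫ x, ‖dampedWave (s ^ 2) a x * (h y * twoPoint ψ x y)‖
          ≤ ∫ x, ‖h y‖ * ‖twoPoint ψ x y‖ := by
            refine integral_mono (hx y).norm ((integrable_twoPoint_left ψ y).norm.const_mul _)
              fun x => ?_
            simp only [norm_mul]
            exact mul_le_of_le_one_left (by positivity) (norm_dampedWave_le hs2.le a x)
        _ ≤ ‖h y‖ * ‖ψ‖ ^ 2 := by
            rw [integral_const_mul]
            exact mul_le_mul_of_nonneg_left (integral_norm_twoPoint_left_le ψ y) (norm_nonneg _)
  calc ∫ z : Phase n, dampedWave (s ^ 2) a z.1 * dampedWave (s ^ 2) b z.2 * wigner η ψ z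
      = ∫ x, dampedWave (s ^ 2) a x * ∫ p, dampedWave (s ^ 2) b p * wigner η ψ (x, p) := by
        rw [Measure.volume_eq_prod] at hint ⊢
        rw [integral_prod _ hint]
        simp only [mul_assoc, integral_const_mul]
    _ = c * ∫ x, ∫ y, dampedWave (s ^ 2) a x * (h y * twoPoint ψ x y) := by
        rw [← integral_const_mul]
        refine integral_congr_ae (.of_forall fun x => ?_)
        simp only [hp, integral_const_mul]
        ring
    _ = c * ∫ y, h y * ∫ x, dampedWave (s ^ 2) a x * twoPoint ψ x y := by
        rw [integral_integral_swap hIxy]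
        simp only [← integral_const_mul, mul_left_comm]
    _ = _ := by
        rw [hsub fun y => h y * ∫ x, dampedWave (s ^ 2) a x * twoPoint ψ x y]
        simp only [hhu]
        simp only [mul_assoc, integral_const_mul]
        simp only [← mul_assoc]
        congr 1
        rw [hc]
        simp only [← Complex.ofReal_mul, ← mul_pow, ← inv_pow]
        congr 2
        rw [abs_mul, abs_mul, abs_two, abs_of_pos hs]
        have h1 : |η| ≠ 0 := abs_ne_zero.2 hη
        have h2 : √Real.pi ≠ 0 := (Real.sqrt_pos.2 Real.pi_pos).ne'
        have h3 := Real.sq_sqrt Real.pi_pos.le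
        field_simp
        exact h3

theorem integral_exp_neg_norm_sq :
    ∫ u : Config n, (Real.exp (-‖u‖ ^ 2) : ℂ) = ((√Real.pi ^ n : ℝ) : ℂ) := by
  have h := integral_dampedWave_mul_exp (n := n) one_ne_zero one_pos 0 0
  have h2 : ∀ p : Config n, (Real.exp (-‖p‖ ^ 2) : ℂ) = dampedWave (1 ^ 2) 0 p := fun p => by
    simp [dampedWave]
  simp only [h2]
  simpa using h

theorem norm_integral_dampedWave_mul_twoPoint_le (s : ℝ) (ψ : StateSpace n) (a y : Config n) :
    ‖∫ x, dampedWave (s ^ 2) a x * twoPoint ψ x y‖ ≤ ‖ψ‖ ^ 2 := by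
  refine (norm_integral_le_of_norm_le (integrable_twoPoint_left ψ y).norm
    (.of_forall fun x => ?_)).trans (integral_norm_twoPoint_left_le ψ y)
  rw [norm_mul]
  exact mul_le_of_le_one_left (norm_nonneg _) (norm_dampedWave_le (sq_nonneg s) a x)

theorem norm_integral_dampedWave_mul_wigner_le {η : ℝ} (hη : η ≠ 0) {s : ℝ} (hs : 0 < s)
    (ψ : StateSpace n) (a b : Config n) :
    ‖∫ z : Phase n, dampedWave (s ^ 2) a z.1 * dampedWave (s ^ 2) b z.2 * wigner η ψ z‖ ≤
      ‖ψ‖ ^ 2 := by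
  have hI : ∫ u : Config n, Real.exp (-‖u‖ ^ 2) = √Real.pi ^ n := by
    have := integral_exp_neg_norm_sq (n := n)
    rw [integral_complex_ofReal] at this
    exact_mod_cast this
  rw [integral_dampedWave_mul_wigner hη hs, norm_mul, Complex.norm_real,
    Real.norm_of_nonneg (by positivity), inv_mul_le_iff₀ (by positivity), ← hI,
    ← integral_mul_const]
  refine norm_integral_le_of_norm_le (integrable_exp_neg_norm_sq.mul_const _)
    (.of_forall fun u => ?_)
  rw [norm_mul, Complex.norm_real, Real.norm_of_nonneg (Real.exp_pos _).le]
  exact mul_le_mul_of_nonneg_left (norm_integral_dampedWave_mul_twoPoint_le s ψ a _)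
    (Real.exp_pos _).le

/-- The Fourier transform of `W_η ψ`, understood as a limit of Gaussian regularizations because
`W_η ψ` need not be integrable, is the ambiguity function of `ψ`. -/
theorem tendsto_integral_dampedWave_mul_wigner {η : ℝ} (hη : η ≠ 0) (ψ : StateSpace n)
    (a b : Config n) :
    Tendsto (fun s : ℝ => ∫ z : Phase n,
        dampedWave (s ^ 2) a z.1 * dampedWave (s ^ 2) b z.2 * wigner η ψ z) (𝓝[>] 0)
      (𝓝 (ambiguity ψ a (η • b))) := by
  have hlim : Tendsto (fun s : ℝ => (((√Real.pi ^ n)⁻¹ : ℝ) : ℂ) *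
      ∫ u : Config n, (Real.exp (-‖u‖ ^ 2) : ℂ) *
        ∫ x, dampedWave (s ^ 2) a x * twoPoint ψ x (η • b + (2 * η * s) • u)) (𝓝[>] 0)
      (𝓝 ((((√Real.pi ^ n)⁻¹ : ℝ) : ℂ) *
        ∫ u : Config n, (Real.exp (-‖u‖ ^ 2) : ℂ) * ambiguity ψ a (η • b))) := by
    refine Tendsto.const_mul _ ?_
    refine tendsto_integral_filter_of_dominated_convergence
      (fun u => Real.exp (-‖u‖ ^ 2) * ‖ψ‖ ^ 2) (.of_forall fun s => ?_)
      (.of_forall fun s => .of_forall fun u => ?_) (integrable_exp_neg_norm_sq.mul_const _)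
      (.of_forall fun u => Tendsto.const_mul _ ?_)
    · refine (Continuous.aestronglyMeasurable (by fun_prop)).mul
        (StronglyMeasurable.aestronglyMeasurable ?_)
      refine StronglyMeasurable.integral_prod_right (f := fun u x : Config n =>
        dampedWave (s ^ 2) a x * twoPoint ψ x (η • b + (2 * η * s) • u)) ?_
      exact ((continuous_dampedWave _ a).stronglyMeasurable.comp_measurable measurable_snd).mul
        ((stronglyMeasurable_twoPoint ψ).comp_measurable
          (g := fun w : Config n × Config n => (w.2, η • b + (2 * η * s) • w.1)) (by fun_prop))
    · rw [norm_mul, Complex.norm_real, Real.norm_of_nonneg (Real.exp_pos _).le]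
      exact mul_le_mul_of_nonneg_left (norm_integral_dampedWave_mul_twoPoint_le s ψ a _)
        (Real.exp_pos _).le
    · refine tendsto_integral_mul_twoPoint ψ (fun s => continuous_dampedWave (s ^ 2) a)
        (fun s x => norm_dampedWave_le (sq_nonneg s) a x) (fun x => tendsto_dampedWave a x) ?_
      have h : Continuous fun s : ℝ => η • b + (2 * η * s) • u := by fun_prop
      have := (h.tendsto 0).mono_left (nhdsWithin_le_nhds (s := Set.Ioi 0))
      simpa using this
  have hval : (((√Real.pi ^ n)⁻¹ : ℝ) : ℂ) *
      ∫ u : Config n, (Real.exp (-‖u‖ ^ 2) : ℂ) * ambiguity ψ a (η • b) =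
      ambiguity ψ a (η • b) := by
    rw [integral_mul_const, integral_exp_neg_norm_sq, ← mul_assoc, ← Complex.ofReal_mul,
      inv_mul_cancel₀ (by positivity), Complex.ofReal_one, one_mul]
  rw [hval] at hlim
  refine hlim.congr' ?_
  filter_upwards [self_mem_nhdsWithin] with s hs
  exact (integral_dampedWave_mul_wigner hη hs ψ a b).symm

/-- The characteristic function `∫ exp (i (a·x + b·p)) ρ(x, p) dx dp` of `ρ`. -/
def charFn (ρ : Phase n → ℝ) (a b : Config n) : ℂ :=
  ∫ z : Phase n, Complex.exp (Complex.I * ((inner ℝ a z.1 + inner ℝ b z.2 : ℝ) : ℂ)) * (ρ z : ℂ)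

variable {η : ℝ} {α : ℕ → ℝ} {ψ : ℕ → StateSpace n} {ρ : Phase n → ℝ}

theorem aestronglyMeasurable_of_hasSum_wigner
    (hρ : ∀ᵐ z : Phase n, HasSum (fun j => (α j : ℂ) * wigner η (ψ j) z) (ρ z : ℂ)) :
    AEStronglyMeasurable ρ := by
  have h : AEStronglyMeasurable (fun z => (ρ z : ℂ)) (volume : Measure (Phase n)) := by
    refine aestronglyMeasurable_of_tendsto_ae atTop
      (f := fun N z => ∑ j ∈ Finset.range N, (α j : ℂ) * wigner η (ψ j) z) (fun N => ?_) ?_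
    · exact (Finset.stronglyMeasurable_fun_sum _ fun j _ =>
        (stronglyMeasurable_wigner η (ψ j)).const_mul _).aestronglyMeasurable
    · filter_upwards [hρ] with z hz using hz.tendsto_sum_nat
  exact Complex.continuous_re.comp_aestronglyMeasurable h

/-- The characteristic function of the Wigner transform of a mixed state is the corresponding
mixture of ambiguity functions. -/
theorem hasSum_ambiguity (hη : η ≠ 0) (hα : ∀ j, 0 ≤ α j) (hα1 : HasSum α 1)
    (hψ : ∀ j, ‖ψ j‖ = 1)
    (hρ : ∀ᵐ z : Phase n, HasSum (fun j => (α j : ℂ) * wigner η (ψ j) z) (ρ z : ℂ))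
    (hint : Integrable ρ) (a b : Config n) :
    HasSum (fun j => (α j : ℂ) * ambiguity (ψ j) a (η • b)) (charFn ρ a b) := by
  set g : ℝ → Phase n → ℂ := fun s z => dampedWave (s ^ 2) a z.1 * dampedWave (s ^ 2) b z.2 with hg
  have hgc : ∀ s, Continuous (g s) := fun s =>
    ((continuous_dampedWave _ a).comp continuous_fst).mul
      ((continuous_dampedWave _ b).comp continuous_snd)
  have hg1 : ∀ s z, ‖g s z‖ ≤ 1 := fun s z => by
    rw [hg, norm_mul]
    exact mul_le_one₀ (norm_dampedWave_le (sq_nonneg s) a _) (norm_nonneg _)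
      (norm_dampedWave_le (sq_nonneg s) b _)
  have hterm : ∀ s j, ∫ z, g s z * ((α j : ℂ) * wigner η (ψ j) z) =
      (α j : ℂ) * ∫ z, g s z * wigner η (ψ j) z := fun s j => by
    rw [← integral_const_mul]
    simp only [mul_left_comm]
  have hnorm : ∀ j, ‖(α j : ℂ)‖ = α j := fun j => by
    rw [Complex.norm_real, Real.norm_of_nonneg (hα j)]
  -- termwise integration of the regularized expansion
  have hsum : ∀ s : ℝ, 0 < s → ∑' j, (α j : ℂ) * ∫ z, g s z * wigner η (ψ j) z =
      ∫ z, g s z * (ρ z : ℂ) := fun s hs => by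
    have hs2 : (0 : ℝ) < s ^ 2 := by positivity
    have hgi : Integrable (g s) := by
      exact (integrable_dampedWave hs2 a).mul_prod (integrable_dampedWave hs2 b)
    set C : ℝ := (1 / (2 * Real.pi * |η|)) ^ n * 2 ^ n with hC
    have hW : ∀ j z, ‖wigner η (ψ j) z‖ ≤ C := fun j z => by
      have := norm_wigner_le η (ψ j) z
      rwa [hψ, one_pow, mul_one] at this
    have hFi : ∀ j, Integrable fun z => g s z * ((α j : ℂ) * wigner η (ψ j) z) := fun j => by
      refine hgi.mul_bdd (c := α j * C)
        ((stronglyMeasurable_wigner η (ψ j)).const_mul _).aestronglyMeasurable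
        (.of_forall fun z => ?_)
      rw [norm_mul, hnorm]
      exact mul_le_mul_of_nonneg_left (hW j z) (hα j)
    have hsm : Summable fun j => ∫ z, ‖g s z * ((α j : ℂ) * wigner η (ψ j) z)‖ := by
      refine Summable.of_nonneg_of_le (fun j => by positivity) (fun j => ?_)
        (hα1.summable.mul_right (C * ∫ z, ‖g s z‖))
      rw [← mul_assoc, ← integral_const_mul]
      refine integral_mono (hFi j).norm (hgi.norm.const_mul _) fun z => ?_
      simp only [norm_mul, hnorm]
      rw [mul_comm]
      exact mul_le_mul_of_nonneg_right (mul_le_mul_of_nonneg_left (hW j z) (hα j)) (by positivity)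
    have h := hasSum_integral_of_summable_integral_norm hFi hsm
    simp only [hterm] at h
    rw [h.tsum_eq]
    refine integral_congr_ae ?_
    filter_upwards [hρ] with z hz
    exact (hz.mul_left (g s z)).tsum_eq
  have hlim1 : Tendsto (fun s : ℝ => ∑' j, (α j : ℂ) * ∫ z, g s z * wigner η (ψ j) z) (𝓝[>] 0)
      (𝓝 (∑' j, (α j : ℂ) * ambiguity (ψ j) a (η • b))) := by
    refine tendsto_tsum_of_dominated_convergence hα1.summable
      (fun j => (tendsto_integral_dampedWave_mul_wigner hη (ψ j) a b).const_mul _) ?_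
    filter_upwards [self_mem_nhdsWithin] with s hs j
    rw [norm_mul, hnorm]
    have := norm_integral_dampedWave_mul_wigner_le hη hs (ψ j) a b
    rw [hψ, one_pow] at this
    exact mul_le_of_le_one_right (hα j) this
  have hlim2 : Tendsto (fun s : ℝ => ∫ z, g s z * (ρ z : ℂ)) (𝓝[>] 0) (𝓝 (charFn ρ a b)) := by
    refine tendsto_integral_filter_of_dominated_convergence (fun z => ‖ρ z‖)
      (.of_forall fun s => (hgc s).aestronglyMeasurable.mul hint.ofReal.aestronglyMeasurable)
      (.of_forall fun s => .of_forall fun z => ?_) hint.norm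
      (.of_forall fun z => Tendsto.mul_const _ ?_)
    · rw [norm_mul, Complex.norm_real]
      exact mul_le_of_le_one_left (norm_nonneg _) (hg1 s z)
    · have := (tendsto_dampedWave a z.1).mul (tendsto_dampedWave b z.2)
      rw [← Complex.exp_add, ← mul_add, ← Complex.ofReal_add] at this
      exact this
  have hA : ∀ j, ‖ambiguity (ψ j) a (η • b)‖ ≤ 1 := fun j => by
    refine (norm_integral_le_integral_norm _).trans ?_
    simp only [norm_mul, norm_exp_I_mul, one_mul]
    have := integral_norm_twoPoint_left_le (ψ j) (η • b)
    rwa [hψ, one_pow] at this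
  have hS : Summable fun j => (α j : ℂ) * ambiguity (ψ j) a (η • b) := by
    refine Summable.of_norm_bounded hα1.summable fun j => ?_
    rw [norm_mul, hnorm]
    exact mul_le_of_le_one_right (hα j) (hA j)
  have heq := tendsto_nhds_unique (hlim1.congr' (by
    filter_upwards [self_mem_nhdsWithin] with s hs using hsum s hs)) hlim2
  rw [← heq]
  exact hS.hasSum

end Characteristic

/-! ### Twisted positivity of the characteristic function -/

section Positivity

open Filter Topology

variable {n : ℕ}

/-- The Weyl translate `exp (i (a·x + a·y/2)) ψ(x + y)` of the wave function `ψ`. -/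
def weylTranslate (ψ : StateSpace n) (a y x : Config n) : ℂ :=
  Complex.exp (Complex.I * ((inner ℝ a x + inner ℝ a y / 2 : ℝ) : ℂ)) * ψ (x + y)

theorem memLp_weylTranslate (ψ : StateSpace n) (a y : Config n) :
    MemLp (weylTranslate ψ a y) 2 volume := by
  have h := (Lp.memLp ψ).comp_measurePreserving (measurePreserving_add_right volume y)
  refine h.of_le ((Continuous.aestronglyMeasurable (by fun_prop)).mul h.aestronglyMeasurable)
    (.of_forall fun x => ?_)
  rw [weylTranslate, norm_mul, norm_exp_I_mul, one_mul]
  rfl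

theorem integrable_weylTranslate_mul_conj (ψ : StateSpace n) (a y a' y' : Config n) :
    Integrable fun x => weylTranslate ψ a y x * starRingEnd ℂ (weylTranslate ψ a' y' x) :=
  (memLp_weylTranslate ψ a y).integrable_mul (memLp_weylTranslate ψ a' y').star

/-- The overlap of two Weyl translates is an ambiguity function, up to the phase given by the
symplectic form. -/
theorem integral_weylTranslate_mul_conj (ψ : StateSpace n) (a y a' y' : Config n) :
    ∫ x, weylTranslate ψ a y x * starRingEnd ℂ (weylTranslate ψ a' y' x) =
      Complex.exp (Complex.I / 2 * ((inner ℝ a' y - inner ℝ a y' : ℝ) : ℂ)) *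
        ambiguity ψ (a - a') (y - y') := by
  rw [← integral_sub_right_eq_self _ ((1 / 2 : ℝ) • (y + y')), ambiguity, ← integral_const_mul]
  refine integral_congr_ae (.of_forall fun x => ?_)
  have h1 : x - (1 / 2 : ℝ) • (y + y') + y = x + (1 / 2 : ℝ) • (y - y') := by module
  have h2 : x - (1 / 2 : ℝ) • (y + y') + y' = x - (1 / 2 : ℝ) • (y - y') := by module
  simp only [weylTranslate, twoPoint, h1, h2, map_mul, ← Complex.exp_conj]
  have h3 : ∀ A B C D e f : ℂ, A * B = C * D → A * e * (B * f) = C * (D * (e * f)) := by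
    intro A B C D e f h
    linear_combination (e * f) * h
  refine h3 _ _ _ _ _ _ ?_
  rw [← Complex.exp_add, ← Complex.exp_add]
  congr 1
  simp only [inner_sub_right, inner_sub_left, inner_smul_right, inner_add_right,
    Complex.conj_I, Complex.conj_ofReal]
  push_cast
  ring

/-- The Hermitian form attached to finitely many Weyl translates of `ψ` is positive, being the
squared norm of a linear combination of them. -/
theorem re_sum_ambiguity_nonneg {κ : Type*} [Fintype κ] (ψ : StateSpace n) (c : κ → ℂ)
    (a y : κ → Config n) :
    0 ≤ (∑ k, ∑ l, c k * starRingEnd ℂ (c l) *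
      (Complex.exp (Complex.I / 2 * ((inner ℝ (a l) (y k) - inner ℝ (a k) (y l) : ℝ) : ℂ)) *
        ambiguity ψ (a k - a l) (y k - y l))).re := by
  have h : ∑ k, ∑ l, c k * starRingEnd ℂ (c l) *
      (Complex.exp (Complex.I / 2 * ((inner ℝ (a l) (y k) - inner ℝ (a k) (y l) : ℝ) : ℂ)) *
        ambiguity ψ (a k - a l) (y k - y l)) =
      ((∫ x, ‖∑ k, c k * weylTranslate ψ (a k) (y k) x‖ ^ 2 : ℝ) : ℂ) := by
    rw [← integral_complex_ofReal]
    simp only [← integral_weylTranslate_mul_conj, ← integral_const_mul]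
    have hI : ∀ k l, Integrable fun x => c k * starRingEnd ℂ (c l) *
        (weylTranslate ψ (a k) (y k) x * starRingEnd ℂ (weylTranslate ψ (a l) (y l) x)) :=
      fun k l => (integrable_weylTranslate_mul_conj ψ _ _ _ _).const_mul _
    simp only [← integral_finsetSum _ fun l _ => hI _ l]
    rw [← integral_finsetSum _ fun k _ => integrable_finsetSum _ fun l _ => hI k l]
    refine integral_congr_ae (.of_forall fun x => ?_)
    simp only [Complex.ofReal_pow, ← Complex.mul_conj', map_sum, Finset.sum_mul_sum, map_mul]
    refine Finset.sum_congr rfl fun k _ => Finset.sum_congr rfl fun l _ => ?_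
    ring
  rw [h, Complex.ofReal_re]
  exact integral_nonneg fun x => by positivity

variable {η : ℝ} {α : ℕ → ℝ} {ψ : ℕ → StateSpace n} {ρ : Phase n → ℝ}

/-- Twisted positive definiteness of the characteristic function of a quantum state (the
Kastler–Loupias–Miracle-Sole condition). -/
theorem re_sum_charFn_nonneg {κ : Type*} [Fintype κ]
    (hη : η ≠ 0) (hα : ∀ j, 0 ≤ α j) (hα1 : HasSum α 1) (hψ : ∀ j, ‖ψ j‖ = 1)
    (hρ : ∀ᵐ z : Phase n, HasSum (fun j => (α j : ℂ) * wigner η (ψ j) z) (ρ z : ℂ))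
    (hint : Integrable ρ) (c : κ → ℂ) (a b : κ → Config n) :
    0 ≤ (∑ k, ∑ l, c k * starRingEnd ℂ (c l) *
      (Complex.exp (Complex.I / 2 *
          ((η * (inner ℝ (a l) (b k) - inner ℝ (a k) (b l)) : ℝ) : ℂ)) *
        charFn ρ (a k - a l) (b k - b l))).re := by
  have hsum := hasSum_sum (s := Finset.univ) fun k _ => hasSum_sum (s := Finset.univ) fun l _ =>
    ((hasSum_ambiguity hη hα hα1 hψ hρ hint (a k - a l) (b k - b l)).mul_left
      (Complex.exp (Complex.I / 2 *
        ((η * (inner ℝ (a l) (b k) - inner ℝ (a k) (b l)) : ℝ) : ℂ)))).mul_left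
      (c k * starRingEnd ℂ (c l))
  refine (Complex.hasSum_re hsum).nonneg fun j => ?_
  have h := mul_nonneg (hα j) (re_sum_ambiguity_nonneg (ψ j) c a fun k => η • b k)
  rw [← Complex.re_ofReal_mul] at h
  refine h.trans_eq (congrArg Complex.re ?_)
  simp only [Finset.mul_sum]
  refine Finset.sum_congr rfl fun k _ => Finset.sum_congr rfl fun l _ => ?_
  simp only [inner_smul_right, ← smul_sub, ← mul_sub]
  ring

theorem charFn_zero (hη : η ≠ 0) (hα : ∀ j, 0 ≤ α j) (hα1 : HasSum α 1) (hψ : ∀ j, ‖ψ j‖ = 1)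
    (hρ : ∀ᵐ z : Phase n, HasSum (fun j => (α j : ℂ) * wigner η (ψ j) z) (ρ z : ℂ))
    (hint : Integrable ρ) : charFn ρ 0 0 = 1 := by
  have h := hasSum_ambiguity hη hα hα1 hψ hρ hint 0 0
  have hamb : ∀ j, ambiguity (ψ j) 0 (η • (0 : Config n)) = 1 := fun j => by
    have h1 := integral_norm_sq (ψ j)
    rw [hψ, one_pow] at h1
    simp only [ambiguity, twoPoint, inner_zero_left, smul_zero, add_zero, sub_zero,
      Complex.mul_conj', Complex.ofReal_zero, mul_zero, Complex.exp_zero, one_mul,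
      ← Complex.ofReal_pow]
    rw [integral_complex_ofReal, h1, Complex.ofReal_one]
  simp only [hamb, mul_one] at h
  exact h.unique (by simpa using Complex.ofRealCLM.hasSum hα1)

end Positivity

/-! ### The second order expansion at the origin -/

section Expansion

open Filter Topology

variable {n : ℕ} {ρ : Phase n → ℝ}

/-- The linear form `a·x + b·p` on phase space. -/
def pairing (a b : Config n) (z : Phase n) : ℝ := inner ℝ a z.1 + inner ℝ b z.2

theorem continuous_pairing (a b : Config n) : Continuous (pairing a b) := by
  unfold pairing
  fun_prop

theorem pairing_sub (a b : Config n) (z m : Phase n) :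
    pairing a b (z - m) = pairing a b z - pairing a b m := by
  simp only [pairing, Prod.fst_sub, Prod.snd_sub, inner_sub_right]
  ring

theorem abs_pairing_sub_le (a b : Config n) (z m : Phase n) :
    |pairing a b (z - m)| ≤
      (‖a‖ * (1 + ‖m.1‖) + ‖b‖ * (1 + ‖m.2‖)) * (1 + ‖z.1‖ + ‖z.2‖) := by
  have h1 := (abs_real_inner_le_norm a (z.1 - m.1)).trans
    (mul_le_mul_of_nonneg_left (norm_sub_le z.1 m.1) (norm_nonneg a))
  have h2 := (abs_real_inner_le_norm b (z.2 - m.2)).trans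
    (mul_le_mul_of_nonneg_left (norm_sub_le z.2 m.2) (norm_nonneg b))
  refine (abs_add_le _ _).trans ((add_le_add h1 h2).trans ?_)
  have e1 : ‖z.1‖ + ‖m.1‖ ≤ (1 + ‖m.1‖) * (1 + ‖z.1‖ + ‖z.2‖) := by
    nlinarith [norm_nonneg z.1, norm_nonneg z.2, norm_nonneg m.1,
      mul_nonneg (norm_nonneg m.1) (norm_nonneg z.1),
      mul_nonneg (norm_nonneg m.1) (norm_nonneg z.2)]
  have e2 : ‖z.2‖ + ‖m.2‖ ≤ (1 + ‖m.2‖) * (1 + ‖z.1‖ + ‖z.2‖) := by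
    nlinarith [norm_nonneg z.1, norm_nonneg z.2, norm_nonneg m.2,
      mul_nonneg (norm_nonneg m.2) (norm_nonneg z.1),
      mul_nonneg (norm_nonneg m.2) (norm_nonneg z.2)]
  have e3 := mul_le_mul_of_nonneg_left e1 (norm_nonneg a)
  have e4 := mul_le_mul_of_nonneg_left e2 (norm_nonneg b)
  linarith

/-- Under the second moment hypothesis, functions of at most quadratic growth are integrable
against `ρ`. -/
theorem integrable_mul_of_le (hm : AEStronglyMeasurable ρ)
    (hdecay : Integrable fun z : Phase n => (1 + (‖z.1‖ ^ 2 + ‖z.2‖ ^ 2)) * |ρ z|)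
    {f : Phase n → ℝ} (hf : Continuous f) {C : ℝ} (hC : 0 ≤ C)
    (hle : ∀ z, |f z| ≤ C * (1 + ‖z.1‖ + ‖z.2‖) ^ 2) : Integrable fun z => f z * ρ z := by
  refine (hdecay.const_mul (3 * C)).mono' (hf.aestronglyMeasurable.mul hm)
    (.of_forall fun z => ?_)
  rw [norm_mul, Real.norm_eq_abs, Real.norm_eq_abs, ← mul_assoc]
  refine mul_le_mul_of_nonneg_right ((hle z).trans ?_) (abs_nonneg _)
  have : (1 + ‖z.1‖ + ‖z.2‖) ^ 2 ≤ 3 * (1 + (‖z.1‖ ^ 2 + ‖z.2‖ ^ 2)) := by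
    nlinarith [sq_nonneg (‖z.1‖ - ‖z.2‖), sq_nonneg (‖z.1‖ - 1), sq_nonneg (‖z.2‖ - 1)]
  nlinarith [mul_le_mul_of_nonneg_left this hC]

theorem integrable_of_decay (hm : AEStronglyMeasurable ρ)
    (hdecay : Integrable fun z : Phase n => (1 + (‖z.1‖ ^ 2 + ‖z.2‖ ^ 2)) * |ρ z|) :
    Integrable ρ := by
  have := integrable_mul_of_le hm hdecay (f := fun _ => 1) continuous_const zero_le_one
    (fun z => by
      have h : (1 : ℝ) ≤ 1 + ‖z.1‖ + ‖z.2‖ := by linarith [norm_nonneg z.1, norm_nonneg z.2]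
      rw [abs_one, one_mul]
      exact one_le_pow₀ h)
  simpa using this

theorem tendsto_exp_sq_sub_one_div (r : ℝ) :
    Tendsto (fun t : ℝ => (Complex.exp (Complex.I / 2 * ((t ^ 2 * r : ℝ) : ℂ)) - 1) /
      ((t ^ 2 : ℝ) : ℂ)) (𝓝[>] 0) (𝓝 (Complex.I / 2 * (r : ℂ))) := by
  have hd : HasDerivAt (fun s : ℝ => Complex.exp (Complex.I / 2 * (r : ℂ) * (s : ℂ)))
      (Complex.I / 2 * (r : ℂ)) 0 := by
    have h1 : HasDerivAt (fun s : ℝ => Complex.I / 2 * (r : ℂ) * (s : ℂ))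
        (Complex.I / 2 * (r : ℂ)) 0 := by
      simpa using (Complex.ofRealCLM.hasDerivAt (x := (0 : ℝ))).const_mul (Complex.I / 2 * (r : ℂ))
    simpa using h1.cexp
  have hsq : Tendsto (fun t : ℝ => t ^ 2) (𝓝[>] 0) (𝓝[>] 0) := by
    refine tendsto_nhdsWithin_iff.2 ⟨?_, ?_⟩
    · have : Continuous fun t : ℝ => t ^ 2 := by fun_prop
      simpa using (this.tendsto 0).mono_left (nhdsWithin_le_nhds (s := Set.Ioi 0))
    · filter_upwards [self_mem_nhdsWithin] with t ht
      exact pow_pos (Set.mem_Ioi.1 ht) 2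
  refine (hd.tendsto_slope_zero_right.comp hsq).congr fun t => ?_
  simp only [Function.comp, zero_add, Complex.real_smul, Complex.ofReal_zero, mul_zero,
    Complex.exp_zero, Complex.ofReal_inv]
  rw [inv_mul_eq_div, Complex.ofReal_mul, mul_assoc, mul_comm (r : ℂ)]

theorem tendsto_sum_exp_div {κ : Type*} [Fintype κ] {γ : κ → ℂ} (hγ : ∑ k, γ k = 0)
    (r : κ → ℝ) :
    Tendsto (fun t : ℝ =>
        ‖(∑ k, γ k * Complex.exp (Complex.I * ((t * r k : ℝ) : ℂ))) / (t : ℂ)‖ ^ 2)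
      (𝓝[>] 0) (𝓝 (‖∑ k, γ k * (r k : ℂ)‖ ^ 2)) := by
  have hd : HasDerivAt (fun t : ℝ => ∑ k, γ k * Complex.exp (Complex.I * ((t * r k : ℝ) : ℂ)))
      (∑ k, γ k * (Complex.I * (r k : ℂ))) 0 := by
    refine HasDerivAt.fun_sum fun k _ => HasDerivAt.const_mul _ ?_
    have h1 : HasDerivAt (fun t : ℝ => Complex.I * ((t * r k : ℝ) : ℂ))
        (Complex.I * (r k : ℂ)) 0 := by
      have := ((hasDerivAt_id (0 : ℝ)).mul_const (r k)).ofReal_comp.const_mul Complex.I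
      simpa using this
    simpa using h1.cexp
  have h := hd.tendsto_slope_zero_right
  simp only [zero_add, zero_mul, Complex.ofReal_zero, mul_zero, Complex.exp_zero, mul_one, hγ,
    sub_zero] at h
  have hI : ‖∑ k, γ k * (Complex.I * (r k : ℂ))‖ = ‖∑ k, γ k * (r k : ℂ)‖ := by
    rw [← one_mul ‖∑ k, γ k * (r k : ℂ)‖, ← Complex.norm_I, ← norm_mul, Finset.mul_sum]
    simp only [mul_left_comm]
  rw [← hI]
  refine (h.norm.pow 2).congr fun t => ?_
  rw [Complex.real_smul, Complex.ofReal_inv, inv_mul_eq_div]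

/-- The second order expansion of the twisted positivity condition at points `t (a k, b k)`,
`t → 0`, with weights of total mass zero. -/
theorem integral_norm_sq_add_nonneg {κ : Type*} [Fintype κ]
    {η : ℝ} {α : ℕ → ℝ} {ψ : ℕ → StateSpace n}
    (hη : η ≠ 0) (hα : ∀ j, 0 ≤ α j) (hα1 : HasSum α 1) (hψ : ∀ j, ‖ψ j‖ = 1)
    (hρ : ∀ᵐ z : Phase n, HasSum (fun j => (α j : ℂ) * wigner η (ψ j) z) (ρ z : ℂ))
    (hdecay : Integrable fun z : Phase n => (1 + (‖z.1‖ ^ 2 + ‖z.2‖ ^ 2)) * |ρ z|)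
    (m : Phase n) {γ : κ → ℂ} (hγ : ∑ k, γ k = 0) (a b : κ → Config n) :
    0 ≤ (∫ z, ‖∑ k, γ k * (pairing (a k) (b k) (z - m) : ℂ)‖ ^ 2 * ρ z) +
      (∑ k, ∑ l, Complex.I / 2 *
        ((η * (inner ℝ (a l) (b k) - inner ℝ (a k) (b l)) : ℝ) : ℂ) *
          (γ k * starRingEnd ℂ (γ l))).re := by
  have hm := aestronglyMeasurable_of_hasSum_wigner hρ
  have hint := integrable_of_decay hm hdecay
  set θ : κ → Phase n → ℝ := fun k z => pairing (a k) (b k) (z - m) with hθ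
  have hθc : ∀ k, Continuous (θ k) := fun k =>
    (continuous_pairing (a k) (b k)).comp (continuous_id.sub continuous_const)
  set σ : κ → κ → ℝ := fun k l => η * (inner ℝ (a l) (b k) - inner ℝ (a k) (b l)) with hσ
  -- `F t z` is the centred trigonometric polynomial, `X t k l` its correlations
  set F : ℝ → Phase n → ℂ := fun t z =>
    ∑ k, γ k * Complex.exp (Complex.I * ((t * θ k z : ℝ) : ℂ)) with hF
  have hFc : ∀ t, Continuous (F t) := fun t => by
    rw [hF]
    fun_prop
  set X : ℝ → κ → κ → ℂ := fun t k l =>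
    ∫ z, Complex.exp (Complex.I * ((t * (θ k z - θ l z) : ℝ) : ℂ)) * (ρ z : ℂ) with hX
  have hexpI : ∀ t k l, Integrable fun z =>
      Complex.exp (Complex.I * ((t * (θ k z - θ l z) : ℝ) : ℂ)) * (ρ z : ℂ) := fun t k l =>
    hint.ofReal.bdd_mul (c := 1) (Continuous.aestronglyMeasurable (by fun_prop))
      (.of_forall fun z => (norm_exp_I_mul _).le)
  have hXF : ∀ t, ∑ k, ∑ l, γ k * starRingEnd ℂ (γ l) * X t k l =
      ((∫ z, ‖F t z‖ ^ 2 * ρ z : ℝ) : ℂ) := fun t => by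
    rw [← integral_complex_ofReal]
    simp only [hX, ← integral_const_mul]
    simp only [← integral_finsetSum _ fun l _ => (hexpI t _ l).const_mul _]
    rw [← integral_finsetSum _ fun k _ => integrable_finsetSum _ fun l _ =>
      (hexpI t k l).const_mul _]
    refine integral_congr_ae (.of_forall fun z => ?_)
    simp only [hF, Complex.ofReal_mul, Complex.ofReal_pow, ← Complex.mul_conj', map_sum,
      Finset.sum_mul_sum, map_mul]
    simp only [Finset.sum_mul]
    refine Finset.sum_congr rfl fun k _ => Finset.sum_congr rfl fun l _ => ?_
    have e : Complex.exp (Complex.I * (t * ((θ k z - θ l z : ℝ) : ℂ))) =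
        Complex.exp (Complex.I * (t * (θ k z : ℂ))) *
          Complex.exp (starRingEnd ℂ (Complex.I * (t * (θ l z : ℂ)))) := by
      rw [← Complex.exp_add]
      congr 1
      simp only [map_mul, Complex.conj_I, Complex.conj_ofReal]
      push_cast
      ring
    rw [e, ← Complex.exp_conj]
    ring
  have hchar : ∀ t k l, charFn ρ (t • a k - t • a l) (t • b k - t • b l) =
      Complex.exp (Complex.I * ((t * (pairing (a k) (b k) m - pairing (a l) (b l) m) : ℝ) : ℂ)) *
        X t k l := fun t k l => by
    rw [charFn, hX, ← integral_const_mul]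
    refine integral_congr_ae (.of_forall fun z => ?_)
    dsimp only
    rw [← mul_assoc, ← Complex.exp_add, ← mul_add, ← Complex.ofReal_add]
    congr 4
    simp only [hθ, pairing_sub]
    simp only [pairing, inner_sub_left, inner_smul_left, conj_trivial]
    ring
  have hpos : ∀ t, 0 ≤ (∑ k, ∑ l, γ k * starRingEnd ℂ (γ l) *
      (Complex.exp (Complex.I / 2 * ((t ^ 2 * σ k l : ℝ) : ℂ)) * X t k l)).re := fun t => by
    -- the phases of the weights shift the origin of phase space to `m`
    have h := re_sum_charFn_nonneg hη hα hα1 hψ hρ hint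
      (fun k => γ k * Complex.exp (Complex.I * ((-(t * pairing (a k) (b k) m) : ℝ) : ℂ)))
      (fun k => t • a k) (fun k => t • b k)
    refine h.trans_eq (congrArg Complex.re ?_)
    refine Finset.sum_congr rfl fun k _ => Finset.sum_congr rfl fun l _ => ?_
    rw [hchar, map_mul, ← Complex.exp_conj]
    have e1 : η * (inner ℝ (t • a l) (t • b k) - inner ℝ (t • a k) (t • b l)) =
        t ^ 2 * σ k l := by
      simp only [hσ, inner_smul_left, inner_smul_right, conj_trivial]
      ring
    rw [e1]
    have e2 : Complex.exp (Complex.I * ((-(t * pairing (a k) (b k) m) : ℝ) : ℂ)) *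
        Complex.exp (starRingEnd ℂ (Complex.I * ((-(t * pairing (a l) (b l) m) : ℝ) : ℂ))) *
        Complex.exp (Complex.I *
          ((t * (pairing (a k) (b k) m - pairing (a l) (b l) m) : ℝ) : ℂ)) = 1 := by
      rw [← Complex.exp_add, ← Complex.exp_add, ← Complex.exp_zero]
      congr 1
      simp only [map_mul, Complex.conj_I, Complex.conj_ofReal]
      push_cast
      ring
    linear_combination (γ k * starRingEnd ℂ (γ l) *
      Complex.exp (Complex.I / 2 * ((t ^ 2 * σ k l : ℝ) : ℂ)) * X t k l) * e2
  have hpos2 : ∀ t : ℝ, 0 < t → 0 ≤ (∫ z, ‖F t z / (t : ℂ)‖ ^ 2 * ρ z) +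
      (∑ k, ∑ l, (Complex.exp (Complex.I / 2 * ((t ^ 2 * σ k l : ℝ) : ℂ)) - 1) /
        ((t ^ 2 : ℝ) : ℂ) * (γ k * starRingEnd ℂ (γ l)) * X t k l).re := fun t ht => by
    have h1 : (∫ z, ‖F t z / (t : ℂ)‖ ^ 2 * ρ z) = (t ^ 2)⁻¹ * ∫ z, ‖F t z‖ ^ 2 * ρ z := by
      rw [← integral_const_mul]
      refine integral_congr_ae (.of_forall fun z => ?_)
      simp only [norm_div, Complex.norm_real, Real.norm_eq_abs, div_pow, sq_abs]
      ring
    have h2 : ∑ k, ∑ l, (Complex.exp (Complex.I / 2 * ((t ^ 2 * σ k l : ℝ) : ℂ)) - 1) /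
        ((t ^ 2 : ℝ) : ℂ) * (γ k * starRingEnd ℂ (γ l)) * X t k l =
        (((t ^ 2)⁻¹ : ℝ) : ℂ) * (∑ k, ∑ l, γ k * starRingEnd ℂ (γ l) *
          (Complex.exp (Complex.I / 2 * ((t ^ 2 * σ k l : ℝ) : ℂ)) * X t k l) -
        ∑ k, ∑ l, γ k * starRingEnd ℂ (γ l) * X t k l) := by
      simp only [← Finset.sum_sub_distrib, Finset.mul_sum]
      refine Finset.sum_congr rfl fun k _ => Finset.sum_congr rfl fun l _ => ?_
      rw [Complex.ofReal_inv]
      ring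
    rw [h1, h2, hXF, Complex.re_ofReal_mul, Complex.sub_re, Complex.ofReal_re, ← mul_add,
      add_sub_cancel]
    exact mul_nonneg (by positivity) (hpos t)
  have hX1 : ∀ k l, Tendsto (fun t => X t k l) (𝓝[>] 0) (𝓝 1) := fun k l => by
    rw [← charFn_zero hη hα hα1 hψ hρ hint, charFn]
    refine tendsto_integral_filter_of_dominated_convergence (fun z => ‖ρ z‖)
      (.of_forall fun t => (hexpI t k l).aestronglyMeasurable)
      (.of_forall fun t => .of_forall fun z => ?_) hint.norm (.of_forall fun z => ?_)
    · rw [norm_mul, norm_exp_I_mul, one_mul, Complex.norm_real]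
    · have h : Continuous fun t : ℝ =>
          Complex.exp (Complex.I * ((t * (θ k z - θ l z) : ℝ) : ℂ)) * (ρ z : ℂ) := by fun_prop
      have := (h.tendsto 0).mono_left (nhdsWithin_le_nhds (s := Set.Ioi 0))
      simpa using this
  have hlim2 : Tendsto (fun t : ℝ => (∑ k, ∑ l,
      (Complex.exp (Complex.I / 2 * ((t ^ 2 * σ k l : ℝ) : ℂ)) - 1) /
        ((t ^ 2 : ℝ) : ℂ) * (γ k * starRingEnd ℂ (γ l)) * X t k l).re) (𝓝[>] 0)
      (𝓝 (∑ k, ∑ l, Complex.I / 2 * (σ k l : ℂ) * (γ k * starRingEnd ℂ (γ l))).re) := by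
    refine (Complex.continuous_re.tendsto _).comp
      (tendsto_finsetSum _ fun k _ => tendsto_finsetSum _ fun l _ => ?_)
    simpa using ((tendsto_exp_sq_sub_one_div (σ k l)).mul_const
      (γ k * starRingEnd ℂ (γ l))).mul (hX1 k l)
  set A : ℝ := ∑ k, ‖γ k‖ * (‖a k‖ * (1 + ‖m.1‖) + ‖b k‖ * (1 + ‖m.2‖)) with hA
  -- the total mass of `γ` being zero, `F t / t` has linear growth uniformly in `t`
  have hFle : ∀ t : ℝ, 0 < t → ∀ z, ‖F t z / (t : ℂ)‖ ≤ A * (1 + ‖z.1‖ + ‖z.2‖) := fun t ht z => by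
    have h : F t z = ∑ k, γ k * (Complex.exp (Complex.I * ((t * θ k z : ℝ) : ℂ)) - 1) := by
      simp only [hF, mul_sub, mul_one, Finset.sum_sub_distrib, hγ, sub_zero]
    rw [norm_div, Complex.norm_real, Real.norm_of_nonneg ht.le, div_le_iff₀ ht, h, hA,
      Finset.sum_mul, Finset.sum_mul]
    refine (norm_sum_le _ _).trans (Finset.sum_le_sum fun k _ => ?_)
    rw [norm_mul, mul_assoc, mul_assoc]
    refine mul_le_mul_of_nonneg_left (Real.norm_exp_I_mul_ofReal_sub_one_le.trans ?_)
      (norm_nonneg _)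
    rw [Real.norm_eq_abs, abs_mul, abs_of_pos ht, mul_comm t, ← mul_assoc]
    exact mul_le_mul_of_nonneg_right (abs_pairing_sub_le _ _ _ _) ht.le
  have hlim1 : Tendsto (fun t : ℝ => ∫ z, ‖F t z / (t : ℂ)‖ ^ 2 * ρ z) (𝓝[>] 0)
      (𝓝 (∫ z, ‖∑ k, γ k * (θ k z : ℂ)‖ ^ 2 * ρ z)) := by
    have hdom : Integrable fun z : Phase n => ‖A ^ 2 * (1 + ‖z.1‖ + ‖z.2‖) ^ 2 * ρ z‖ :=
      (integrable_mul_of_le hm hdecay (by fun_prop) (sq_nonneg A)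
        fun z => (abs_of_nonneg (by positivity)).le).norm
    refine tendsto_integral_filter_of_dominated_convergence _
      (.of_forall fun t => ?_) ?_ hdom (.of_forall fun z => ?_)
    · exact (((hFc t).div_const _).norm.pow 2).aestronglyMeasurable.mul hm
    · filter_upwards [self_mem_nhdsWithin] with t ht
      refine .of_forall fun z => ?_
      rw [norm_mul, norm_mul _ (ρ z)]
      refine mul_le_mul_of_nonneg_right ?_ (norm_nonneg _)
      rw [← mul_pow, norm_pow, norm_norm, Real.norm_of_nonneg (by positivity)]
      exact pow_le_pow_left₀ (norm_nonneg _) (hFle t ht z) 2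
    · exact (tendsto_sum_exp_div hγ fun k => θ k z).mul_const _
  refine ge_of_tendsto (hlim1.add hlim2) ?_
  filter_upwards [self_mem_nhdsWithin] with t ht using hpos2 t ht

end Expansion

/-! ### The uncertainty principle for the covariance matrix -/

section Covariance

open Matrix

variable {n : ℕ} {ρ : Phase n → ℝ}

/-- The position part of a vector of coordinates. -/
def positionPart (v : Fin n ⊕ Fin n → ℝ) : Config n := WithLp.toLp 2 fun j => v (.inl j)

/-- The momentum part of a vector of coordinates. -/
def momentumPart (v : Fin n ⊕ Fin n → ℝ) : Config n := WithLp.toLp 2 fun j => v (.inr j)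

theorem pairing_eq_sum (v : Fin n ⊕ Fin n → ℝ) (z : Phase n) :
    pairing (positionPart v) (momentumPart v) z = ∑ a, v a * coord z a := by
  simp [pairing, positionPart, momentumPart, coord, PiLp.inner_apply, mul_comm]

/-- The centre of `ρ` in phase space. -/
def centre (ρ : Phase n → ℝ) : Phase n :=
  (positionPart (average ρ), momentumPart (average ρ))

theorem coord_centre (ρ : Phase n → ℝ) (a : Fin n ⊕ Fin n) :
    coord (centre ρ) a = average ρ a := by
  rcases a with a | a <;> rfl

theorem pairing_sub_centre (v : Fin n ⊕ Fin n → ℝ) (z : Phase n) :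
    pairing (positionPart v) (momentumPart v) (z - centre ρ) =
      ∑ a, v a * (coord z a - average ρ a) := by
  rw [pairing_sub, pairing_eq_sum, pairing_eq_sum, ← Finset.sum_sub_distrib]
  simp only [coord_centre, mul_sub]

theorem continuous_coord (a : Fin n ⊕ Fin n) : Continuous fun z : Phase n => coord z a := by
  rcases a with a | a
  · change Continuous fun z : Phase n => z.1 a
    fun_prop
  · change Continuous fun z : Phase n => z.2 a
    fun_prop

theorem abs_coord_sub_le (z : Phase n) (a : Fin n ⊕ Fin n) (c : ℝ) :
    |coord z a - c| ≤ (1 + |c|) * (1 + ‖z.1‖ + ‖z.2‖) := by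
  have h : |coord z a| ≤ ‖z.1‖ + ‖z.2‖ := by
    rcases a with a | a
    · have := PiLp.norm_apply_le z.1 a
      exact this.trans (le_add_of_nonneg_right (norm_nonneg _))
    · have := PiLp.norm_apply_le z.2 a
      exact this.trans (le_add_of_nonneg_left (norm_nonneg _))
  have h2 := abs_sub (coord z a) c
  nlinarith [abs_nonneg c, norm_nonneg z.1, norm_nonneg z.2,
    mul_nonneg (abs_nonneg c) (add_nonneg (norm_nonneg z.1) (norm_nonneg z.2))]

theorem covMatrix_isHermitian (ρ : Phase n → ℝ) : (covMatrix ρ).IsHermitian := by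
  ext a b
  simp only [covMatrix, conjTranspose_apply, of_apply, star_trivial,
    mul_comm (coord _ b - average ρ b)]

theorem integrable_cov (hm : AEStronglyMeasurable ρ)
    (hdecay : Integrable fun z : Phase n => (1 + (‖z.1‖ ^ 2 + ‖z.2‖ ^ 2)) * |ρ z|)
    (a b : Fin n ⊕ Fin n) :
    Integrable fun z => (coord z a - average ρ a) * (coord z b - average ρ b) * ρ z := by
  refine integrable_mul_of_le hm hdecay (((continuous_coord a).sub continuous_const).mul
    ((continuous_coord b).sub continuous_const))
    (C := (1 + |average ρ a|) * (1 + |average ρ b|)) (by positivity) fun z => ?_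
  rw [abs_mul]
  refine (mul_le_mul (abs_coord_sub_le z a _) (abs_coord_sub_le z b _) (abs_nonneg _)
    (by positivity)).trans_eq ?_
  ring

theorem quadForm_covMatrix (hm : AEStronglyMeasurable ρ)
    (hdecay : Integrable fun z : Phase n => (1 + (‖z.1‖ ^ 2 + ‖z.2‖ ^ 2)) * |ρ z|)
    (v : Fin n ⊕ Fin n → ℝ) :
    v ⬝ᵥ (covMatrix ρ *ᵥ v) =
      ∫ z, pairing (positionPart v) (momentumPart v) (z - centre ρ) ^ 2 * ρ z := by
  have hI : ∀ a b, Integrable fun z => v a * v b *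
      ((coord z a - average ρ a) * (coord z b - average ρ b) * ρ z) := fun a b =>
    (integrable_cov hm hdecay a b).const_mul _
  have h1 : v ⬝ᵥ (covMatrix ρ *ᵥ v) = ∑ a, ∑ b, ∫ z, v a * v b *
      ((coord z a - average ρ a) * (coord z b - average ρ b) * ρ z) := by
    simp only [dotProduct, mulVec, covMatrix, of_apply, Finset.mul_sum, integral_const_mul]
    refine Finset.sum_congr rfl fun a _ => Finset.sum_congr rfl fun b _ => ?_
    ring
  rw [h1]
  simp only [← integral_finsetSum _ fun b _ => hI _ b]
  rw [← integral_finsetSum _ fun a _ => integrable_finsetSum _ fun b _ => hI a b]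
  refine integral_congr_ae (.of_forall fun z => ?_)
  simp only [pairing_sub_centre, sq, Finset.sum_mul_sum]
  simp only [Finset.sum_mul]
  refine Finset.sum_congr rfl fun a _ => Finset.sum_congr rfl fun b _ => ?_
  ring

theorem dotProduct_stdJ_mulVec (u w : Fin n ⊕ Fin n → ℝ) :
    u ⬝ᵥ (stdJ n *ᵥ w) = inner ℝ (positionPart u) (momentumPart w) -
      inner ℝ (positionPart w) (momentumPart u) := by
  have hw : w = Sum.elim (fun j => w (.inl j)) (fun j => w (.inr j)) := by
    ext (j | j) <;> rfl
  rw [stdJ, hw, fromBlocks_mulVec]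
  simp [positionPart, momentumPart, PiLp.inner_apply, neg_mulVec,
    dotProduct, mul_comm, sub_eq_add_neg]

variable {η : ℝ} {α : ℕ → ℝ} {ψ : ℕ → StateSpace n}

/-- The Robertson–Schrödinger uncertainty principle in real form. -/
theorem mul_dotProduct_stdJ_le (hη : η ≠ 0) (hα : ∀ j, 0 ≤ α j) (hα1 : HasSum α 1)
    (hψ : ∀ j, ‖ψ j‖ = 1)
    (hρ : ∀ᵐ z : Phase n, HasSum (fun j => (α j : ℂ) * wigner η (ψ j) z) (ρ z : ℂ))
    (hdecay : Integrable fun z : Phase n => (1 + (‖z.1‖ ^ 2 + ‖z.2‖ ^ 2)) * |ρ z|)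
    (u w : Fin n ⊕ Fin n → ℝ) :
    η * (u ⬝ᵥ (stdJ n *ᵥ w)) ≤
      u ⬝ᵥ (covMatrix ρ *ᵥ u) + w ⬝ᵥ (covMatrix ρ *ᵥ w) := by
  have hm := aestronglyMeasurable_of_hasSum_wigner hρ
  -- the weights `-1 - i, 1, i` at `0, u, w` produce the linear form `u + i w`
  have h := integral_norm_sq_add_nonneg hη hα hα1 hψ hρ hdecay (centre ρ)
    (γ := ![-1 - Complex.I, 1, Complex.I]) (by simp [Fin.sum_univ_three]; ring)
    ![0, positionPart u, positionPart w] ![0, momentumPart u, momentumPart w]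
  have hsq : ∀ v, Integrable fun z =>
      pairing (positionPart v) (momentumPart v) (z - centre ρ) ^ 2 * ρ z := fun v => by
    refine integrable_mul_of_le hm hdecay (((continuous_pairing _ _).comp
      (continuous_id.sub continuous_const)).pow 2)
      (C := (‖positionPart v‖ * (1 + ‖(centre ρ).1‖) +
        ‖momentumPart v‖ * (1 + ‖(centre ρ).2‖)) ^ 2) (by positivity) fun z => ?_
    rw [abs_pow, ← mul_pow]
    exact pow_le_pow_left₀ (abs_nonneg _) (abs_pairing_sub_le _ _ _ _) 2
  have hnorm : ∀ x y : ℝ, ‖(x : ℂ) + Complex.I * (y : ℂ)‖ ^ 2 = x ^ 2 + y ^ 2 := fun x y => by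
    rw [← Complex.normSq_eq_norm_sq, mul_comm, Complex.normSq_add_mul_I]
  have hz : ∀ z : Phase n, pairing 0 0 z = 0 := fun z => by simp [pairing]
  simp only [Fin.sum_univ_three, cons_val_zero, cons_val_one, cons_val, hz, Complex.ofReal_zero,
    mul_zero, zero_add, one_mul, hnorm, add_mul] at h
  rw [integral_add (hsq u) (hsq w), ← quadForm_covMatrix hm hdecay,
    ← quadForm_covMatrix hm hdecay] at h
  rw [dotProduct_stdJ_mulVec]
  simp at h
  linarith

theorem uncertaintyMatrix_covMatrix_posSemidef (hη : η ≠ 0) (hα : ∀ j, 0 ≤ α j)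
    (hα1 : HasSum α 1) (hψ : ∀ j, ‖ψ j‖ = 1)
    (hρ : ∀ᵐ z : Phase n, HasSum (fun j => (α j : ℂ) * wigner η (ψ j) z) (ρ z : ℂ))
    (hdecay : Integrable fun z : Phase n => (1 + (‖z.1‖ ^ 2 + ‖z.2‖ ^ 2)) * |ρ z|) :
    (uncertaintyMatrix (covMatrix ρ) η).PosSemidef := by
  have hherm := uncertaintyMatrix_isHermitian (covMatrix_isHermitian ρ) η
  refine .of_dotProduct_mulVec_nonneg hherm fun v => ?_
  rw [Complex.nonneg_iff]
  refine ⟨?_, (hherm.im_star_dotProduct_mulVec_self v).symm⟩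
  rw [uncertaintyMatrix_eq, add_mulVec, smul_mulVec, dotProduct_add, dotProduct_smul, smul_eq_mul,
    Complex.add_re, Complex.re_ofReal_mul, re_quadForm_map, re_quadForm_hermJ]
  linarith [mul_dotProduct_stdJ_le hη hα hα1 hψ hρ hdecay (fun i => (v i).re) fun i => (v i).im]

/-- A vector of vanishing variance would violate the uncertainty principle, paired with small
multiples of its symplectic conjugate. -/
theorem covMatrix_posDef (hη : η ≠ 0) (hα : ∀ j, 0 ≤ α j)
    (hα1 : HasSum α 1) (hψ : ∀ j, ‖ψ j‖ = 1)
    (hρ : ∀ᵐ z : Phase n, HasSum (fun j => (α j : ℂ) * wigner η (ψ j) z) (ρ z : ℂ))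
    (hdecay : Integrable fun z : Phase n => (1 + (‖z.1‖ ^ 2 + ‖z.2‖ ^ 2)) * |ρ z|) :
    (covMatrix ρ).PosDef := by
  refine .of_dotProduct_mulVec_pos (covMatrix_isHermitian ρ) fun u hu => ?_
  rw [star_trivial]
  by_contra! hle
  have hq : 0 < u ⬝ᵥ u := by
    simpa using (dotProduct_star_self_pos_iff (v := u)).2 hu
  set C := (stdJ n *ᵥ u) ⬝ᵥ (covMatrix ρ *ᵥ (stdJ n *ᵥ u)) with hC
  set r : ℝ := u ⬝ᵥ u / (2 * (|C| + 1)) with hr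
  have hr0 : 0 < r := by positivity
  have h := mul_dotProduct_stdJ_le hη hα hα1 hψ hρ hdecay u (-(η * r) • (stdJ n *ᵥ u))
  have hJJ : stdJ n *ᵥ (stdJ n *ᵥ u) = -u := by
    rw [mulVec_mulVec, stdJ_mul_self, neg_mulVec, one_mulVec]
  simp only [mulVec_smul, smul_dotProduct, dotProduct_smul, smul_eq_mul, hJJ, dotProduct_neg,
    ← hC] at h
  have h1 : η ^ 2 * r * (u ⬝ᵥ u) ≤ η ^ 2 * r * (r * C) := by
    linarith
  have h2 := le_of_mul_le_mul_left h1 (by positivity)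
  have h3 : r * C ≤ r * (|C| + 1) :=
    mul_le_mul_of_nonneg_left ((le_abs_self C).trans (by linarith)) hr0.le
  have h4 : r * (|C| + 1) = u ⬝ᵥ u / 2 := by
    rw [hr]
    field_simp
  linarith

end Covariance

end EtaQuantum

end

theorem mainTheorem3 (n : ℕ) (hn : 1 ≤ n) (η : ℝ) (hη : η ≠ 0)
    (T : EtaQuantum.StateSpace n →L[ℂ] EtaQuantum.StateSpace n)
    (hT : EtaQuantum.IsDensityMatrix T)
    (ρ : EtaQuantum.Phase n → ℝ)
    (hρ : EtaQuantum.IsWignerTransform η T ρ)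
    (hdecay : MeasureTheory.Integrable
      (fun z : EtaQuantum.Phase n => (1 + (‖z.1‖ ^ 2 + ‖z.2‖ ^ 2)) * |ρ z|)
      MeasureTheory.volume) :
    (EtaQuantum.uncertaintyMatrix (EtaQuantum.covMatrix ρ) η).PosSemidef ∧
    (EtaQuantum.covMatrix ρ).PosDef ∧
    ∃ lmin : ℝ, IsLeast (EtaQuantum.symplecticEigenvalues (EtaQuantum.covMatrix ρ)) lmin ∧
      (∀ η₁ : ℝ, (EtaQuantum.uncertaintyMatrix (EtaQuantum.covMatrix ρ) η₁).PosSemidef ↔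
        |η₁| ≤ 2 * lmin) ∧
      (∀ η₁ η₂ : ℝ, |η₂| ≤ |η₁| →
        ((EtaQuantum.uncertaintyMatrix (EtaQuantum.covMatrix ρ) η₁).PosSemidef →
          (EtaQuantum.uncertaintyMatrix (EtaQuantum.covMatrix ρ) η₂).PosSemidef) ∧
        (|η₁| ≤ 2 * lmin → |η₂| ≤ 2 * lmin)) := by
  obtain ⟨α, ψ, hα, hα1, hψ, -, hW⟩ := hρ
  have hpd := EtaQuantum.covMatrix_posDef hη hα hα1 hψ hW hdecay
  obtain ⟨l, hl, hiff⟩ := EtaQuantum.exists_isLeast_symplecticEigenvalues hn hpd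
  exact ⟨EtaQuantum.uncertaintyMatrix_covMatrix_posSemidef hη hα hα1 hψ hW hdecay, hpd, l, hl,
    hiff, fun η₁ η₂ h => ⟨fun h1 => (hiff η₂).2 (h.trans ((hiff η₁).1 h1)), h.trans⟩⟩
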